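/- Let $n\ge 1$ and let $\Omega\subset\mathbb{R}^n$ be a bounded, open, simply connected (in particular nonempty and path connected) set with Lipschitz boundary. For $1<p<\infty$ let $\Lambda_p^p$, $\Lambda_p\ge 0$, be the first nontrivial Neumann eigenvalue of the $p$-Laplacian, that is, $$\Lambda_p^p=\inf\left\{\frac{\int_\Omega|\nabla v|^p\,dx}{\int_\Omega|v|^p\,dx}\;:\; v\in W^{1,p}(\Omega),\ v\not\equiv 0,\ \int_\Omega|v|^{p-2}v\,dx=0\right\}.$$ For $x,y\in\Omega$ let $d_\Omega(x,y)$ be the intrinsic distance, that is, the infimum of the lengths of the continuous curves in $\Omega$ joining $x$ to $y$, and let $\operatorname{diam}(\Omega)=\sup_{x,y\in\Omega}d_\Omega(x,y)$ be the intrinsic diameter. Then $0<\operatorname{diam}(\Omega)<\infty$ and $$\lim_{p\to\infty}\Lambda_p=\Lambda_\infty:=\frac{2}{\operatorname{diam}(\Omega)}.$$ -/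

import Mathlib

open MeasureTheory Filter Topology Set
open scoped ContDiff ENNReal RealInnerProductSpace

namespace NeumannPLaplace

/-- Euclidean space `ℝⁿ` with the Euclidean norm. -/
abbrev E (n : ℕ) : Type := EuclideanSpace ℝ (Fin n)

/-- `Ω` has Lipschitz boundary: near every boundary point there is a unit direction `ν` such that
`Ω` is the strict epigraph, in the direction `ν`, of a Lipschitz function of the coordinates
orthogonal to `ν`. -/
def HasLipschitzBoundary {n : ℕ} (Ω : Set (E n)) : Prop :=
  ∀ z ∈ frontier Ω, ∃ ν : E n, ‖ν‖ = 1 ∧ ∃ (K : NNReal) (g : (Submodule.span ℝ {ν})ᗮ → ℝ),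
    LipschitzWith K g ∧
      ∀ᶠ x in 𝓝 z, x ∈ Ω ↔ g ((Submodule.span ℝ {ν})ᗮ.orthogonalProjectionOnto x) < ⟪ν, x⟫

/-- The intrinsic (geodesic) distance of `x` and `y` in `Ω`: the infimum of the lengths of the
continuous curves in `Ω` that join `x` to `y`. -/
noncomputable def intrinsicDist {n : ℕ} (Ω : Set (E n)) (x y : E n) : ℝ≥0∞ :=
  ⨅ (γ : ℝ → E n) (_ : ContinuousOn γ (Icc 0 1) ∧ MapsTo γ (Icc 0 1) Ω ∧ γ 0 = x ∧ γ 1 = y),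
    eVariationOn γ (Icc 0 1)

/-- The intrinsic diameter of `Ω`. -/
noncomputable def intrinsicDiam {n : ℕ} (Ω : Set (E n)) : ℝ≥0∞ :=
  ⨆ (x ∈ Ω) (y ∈ Ω), intrinsicDist Ω x y

/-- `G` is the weak gradient of `v` in `Ω`: both are locally integrable in `Ω`, and
`∫_Ω v ∂ₑφ = - ∫_Ω ⟨G, e⟩ φ` for all directions `e` and all test functions `φ ∈ C_c^∞(Ω)`. -/
def HasWeakGradientOn {n : ℕ} (Ω : Set (E n)) (v : E n → ℝ) (G : E n → E n) : Prop :=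
  LocallyIntegrableOn v Ω ∧ LocallyIntegrableOn G Ω ∧
    ∀ φ : E n → ℝ, ContDiff ℝ ∞ φ → HasCompactSupport φ → tsupport φ ⊆ Ω → ∀ e : E n,
      ∫ x in Ω, v x * fderiv ℝ φ x e = -∫ x in Ω, ⟪G x, e⟫ * φ x

/-- `v ∈ W^{1,p}(Ω)`, with weak gradient `G`. -/
def MemW1p {n : ℕ} (Ω : Set (E n)) (p : ℝ) (v : E n → ℝ) (G : E n → E n) : Prop :=
  MemLp v (ENNReal.ofReal p) (volume.restrict Ω) ∧
    MemLp G (ENNReal.ofReal p) (volume.restrict Ω) ∧ HasWeakGradientOn Ω v G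

/-- The set of values `∫_Ω |∇v|^p / ∫_Ω |v|^p` of the Rayleigh quotient over the nonzero
`v ∈ W^{1,p}(Ω)` that satisfy `∫_Ω |v|^{p-2} v = 0`. -/
def rayleighValues {n : ℕ} (Ω : Set (E n)) (p : ℝ) : Set ℝ :=
  {r | ∃ (v : E n → ℝ) (G : E n → E n), MemW1p Ω p v G ∧ ¬ (v =ᵐ[volume.restrict Ω] 0) ∧
    ∫ x in Ω, |v x| ^ (p - 2) * v x = 0 ∧
    r = (∫ x in Ω, ‖G x‖ ^ p) / ∫ x in Ω, |v x| ^ p}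

/-- The first nontrivial Neumann eigenvalue `Λ_p^p` of `-Δ_p` on `Ω`, `1 < p < ∞`, by its
variational definition. -/
noncomputable def neumannEigenvalue {n : ℕ} (Ω : Set (E n)) (p : ℝ) : ℝ :=
  sInf (rayleighValues Ω p)

/-- `Λ_p`, the `p`-th root of the first nontrivial Neumann eigenvalue of `-Δ_p` on `Ω`. -/
noncomputable def neumannLambda {n : ℕ} (Ω : Set (E n)) (p : ℝ) : ℝ :=
  (neumannEigenvalue Ω p) ^ (1 / p)

end NeumannPLaplace

/-! Write `D` for the intrinsic diameter. The limit `2 / D` comes from two bounds of the Rayleigh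
quotient whose other constants do not depend on `p` and so disappear under the `p`-th root.

Upper bound (`exists_rayleighValues_le`): the intrinsic distance `u` from a point `x₀` is locally
1-Lipschitz, so its gradient has norm at most 1. If `y₀` is at nearly the distance `D` from `x₀` and
`s < D / 2`, then for every constant `c` one has `|u - c| ≥ s` on a fixed ball about one of the two
points. With `c` chosen to meet the normalization, the quotient of `u - c` is at most `Q / s ^ p`.

Lower bound (`exists_poincare`, `exists_le_rayleighValues`): mollify `v` at a scale fixed before
`p`. By Jensen the mollified gradient is bounded pointwise by `B ^ (1 / p) * ‖G‖_p`, where `B`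
bounds the kernel. Along almost shortest curves this controls the oscillation of the mollification
on a compact `K ⊆ Ω` by `D + ε` times that bound (`exists_scale_dist_le`), so it stays within half
of this from a constant. The Lipschitz boundary gives a uniform cone condition: small translations
carry the patches of a finite cover of `Ω` into `K`, at an `L^p` cost of at most `ε * ‖G‖_p` in
total. Finally, `∫ |v|^{p-2} v = 0` says that `0` is the best constant approximation of `v` in
`L^p`. -/

namespace NeumannPLaplace

/-! ### The intrinsic distance. -/

theorem edist_le_intrinsicDist {n : ℕ} (Ω : Set (E n)) (x y : E n) :
    edist x y ≤ intrinsicDist Ω x y := by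
  refine le_iInf₂ fun γ hγ => ?_
  rw [← hγ.2.2.1, ← hγ.2.2.2]
  exact eVariationOn.edist_le γ (by simp) (by simp)

theorem intrinsicDist_le_edist_of_segment_subset {n : ℕ} {Ω : Set (E n)} {x y : E n}
    (h : segment ℝ x y ⊆ Ω) : intrinsicDist Ω x y ≤ edist x y := by
  have h1 : LipschitzWith (nndist x y) (AffineMap.lineMap x y : ℝ → E n) :=
    lipschitzWith_lineMap x y
  have hm : MapsTo (AffineMap.lineMap x y : ℝ → E n) (Icc 0 1) Ω := fun t ht => h <| by
    rw [segment_eq_image_lineMap]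
    exact ⟨t, ht, rfl⟩
  refine (iInf₂_le (AffineMap.lineMap x y : ℝ → E n)
    ⟨h1.continuous.continuousOn, hm, by simp, by simp⟩).trans ?_
  have h2 := (h1.lipschitzOnWith (s := univ)).comp_eVariationOn_le
    (g := (id : ℝ → ℝ)) (s := Icc (0:ℝ) 1) (fun _ _ => mem_univ _)
  have h3 : eVariationOn (id : ℝ → ℝ) (Icc (0:ℝ) 1) = ENNReal.ofReal (1 - 0) := by
    have := (monotone_id.monotoneOn (Icc (0:ℝ) 1)).eVariationOn_eq
      (show (0:ℝ) ∈ Icc (0:ℝ) 1 by simp) (show (1:ℝ) ∈ Icc (0:ℝ) 1 by simp)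
    rwa [inter_self] at this
  calc _ ≤ _ := h2
    _ ≤ (nndist x y : ℝ≥0∞) * ENNReal.ofReal (1 - 0) := by rw [h3]
    _ = edist x y := by rw [sub_zero, ENNReal.ofReal_one, mul_one, edist_nndist]

theorem intrinsicDist_le_edist_of_ball {n : ℕ} {Ω : Set (E n)} {c x y : E n} {r : ℝ}
    (h : Metric.ball c r ⊆ Ω) (hx : x ∈ Metric.ball c r) (hy : y ∈ Metric.ball c r) :
    intrinsicDist Ω x y ≤ edist x y :=
  intrinsicDist_le_edist_of_segment_subset (((convex_ball c r).segment_subset hx hy).trans h)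

theorem intrinsicDist_le_symm {n : ℕ} (Ω : Set (E n)) (x y : E n) :
    intrinsicDist Ω x y ≤ intrinsicDist Ω y x := by
  refine le_iInf₂ fun γ hγ => ?_
  obtain ⟨hc, hm, h0, h1⟩ := hγ
  have hφ : MapsTo (fun t : ℝ => 1 - t) (Icc 0 1) (Icc 0 1) := fun t ht => by
    simp only [mem_Icc] at ht ⊢; constructor <;> linarith
  refine (iInf₂_le (γ ∘ fun t : ℝ => 1 - t)
    ⟨hc.comp (by fun_prop) hφ, hm.comp hφ, by simp [h1], by simp [h0]⟩).trans ?_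
  exact eVariationOn.comp_le_of_antitoneOn γ _ (fun a _ b _ hab => sub_le_sub_left hab 1) hφ

theorem intrinsicDist_comm {n : ℕ} (Ω : Set (E n)) (x y : E n) :
    intrinsicDist Ω x y = intrinsicDist Ω y x :=
  le_antisymm (intrinsicDist_le_symm Ω x y) (intrinsicDist_le_symm Ω y x)

theorem intrinsicDist_triangle {n : ℕ} (Ω : Set (E n)) (x y z : E n) :
    intrinsicDist Ω x z ≤ intrinsicDist Ω x y + intrinsicDist Ω y z := by
  conv_rhs => unfold intrinsicDist
  refine ENNReal.le_iInf₂_add_iInf₂ fun γ hγ η hη => ?_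
  obtain ⟨hγc, hγm, hγ0, hγ1⟩ := hγ
  obtain ⟨hηc, hηm, hη0, hη1⟩ := hη
  set ζ : ℝ → E n := fun t => if t ≤ 1 / 2 then γ (2 * t) else η (2 * t - 1) with hζ
  have e1 : EqOn ζ (γ ∘ fun t : ℝ => 2 * t) (Icc 0 (1/2)) := fun t ht => by
    simp only [hζ, Function.comp]; rw [if_pos ht.2]
  have e2 : EqOn ζ (η ∘ fun t : ℝ => 2 * t - 1) (Icc (1/2) 1) := fun t ht => by
    simp only [hζ, Function.comp]
    split_ifs with h
    · have : t = 1 / 2 := le_antisymm h ht.1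
      subst this; norm_num [hγ1, hη0]
    · rfl
  have m1 : MapsTo (fun t : ℝ => 2 * t) (Icc 0 (1/2)) (Icc 0 1) := fun t ht => by
    simp only [mem_Icc] at ht ⊢; constructor <;> linarith
  have m2 : MapsTo (fun t : ℝ => 2 * t - 1) (Icc (1/2) 1) (Icc 0 1) := fun t ht => by
    simp only [mem_Icc] at ht ⊢; constructor <;> linarith
  have hU : Icc (0:ℝ) 1 = Icc 0 (1/2) ∪ Icc (1/2) 1 :=
    (Icc_union_Icc_eq_Icc (by norm_num) (by norm_num)).symm
  have hζc : ContinuousOn ζ (Icc 0 1) := by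
    rw [hU]
    refine ContinuousOn.union_of_isClosed ?_ ?_ isClosed_Icc isClosed_Icc
    · exact (hγc.comp (by fun_prop) m1).congr e1
    · exact (hηc.comp (by fun_prop) m2).congr e2
  have hζm : MapsTo ζ (Icc 0 1) Ω := by
    rw [hU]
    rintro t (ht | ht)
    · rw [e1 ht]; exact hγm (m1 ht)
    · rw [e2 ht]; exact hηm (m2 ht)
  have hζ1 : ζ 1 = z := by
    rw [e2 (by norm_num)]; norm_num [hη1]
  refine (iInf₂_le ζ ⟨hζc, hζm, by simp [hζ, hγ0], hζ1⟩).trans ?_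
  have hadd := eVariationOn.Icc_add_Icc ζ (s := univ) (a := (0:ℝ)) (b := 1/2) (c := 1)
    (by norm_num) (by norm_num) (mem_univ _)
  simp only [univ_inter] at hadd
  rw [← hadd, eVariationOn.congr e1, eVariationOn.congr e2]
  gcongr
  · exact eVariationOn.comp_le_of_monotoneOn γ _ (fun a _ b _ hab => by simpa using hab) m1
  · exact eVariationOn.comp_le_of_monotoneOn η _ (fun a _ b _ hab => by simpa using hab) m2

/-- Small balls in `Ω` have finite intrinsic radius, so the points at finite distance from `x` and
those at infinite distance both form open sets; connectedness excludes the second. -/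
theorem intrinsicDist_lt_top {n : ℕ} {Ω : Set (E n)} (hopen : IsOpen Ω) (hc : IsPreconnected Ω)
    {x y : E n} (hx : x ∈ Ω) (hy : y ∈ Ω) : intrinsicDist Ω x y < ⊤ := by
  have key : ∀ z ∈ Ω, ∃ r > 0, Metric.ball z r ⊆ Ω ∧ ∀ w ∈ Metric.ball z r,
      intrinsicDist Ω z w < ⊤ := fun z hz => by
    obtain ⟨r, hr, hb⟩ := Metric.isOpen_iff.1 hopen z hz
    exact ⟨r, hr, hb, fun w hw => (intrinsicDist_le_edist_of_ball hb
      (Metric.mem_ball_self hr) hw).trans_lt (edist_lt_top _ _)⟩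
  by_contra hcon
  set A := {z | z ∈ Ω ∧ intrinsicDist Ω x z < ⊤} with hA
  set B := {z | z ∈ Ω ∧ ¬ intrinsicDist Ω x z < ⊤} with hB
  have oA : IsOpen A := Metric.isOpen_iff.2 fun z hz => by
    obtain ⟨r, hr, hb, h⟩ := key z hz.1
    exact ⟨r, hr, fun w hw => ⟨hb hw, (intrinsicDist_triangle Ω x z w).trans_lt
      (ENNReal.add_lt_top.2 ⟨hz.2, h w hw⟩)⟩⟩
  have oB : IsOpen B := Metric.isOpen_iff.2 fun z hz => by
    obtain ⟨r, hr, hb, h⟩ := key z hz.1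
    refine ⟨r, hr, fun w hw => ⟨hb hw, fun hlt => hz.2 ?_⟩⟩
    refine (intrinsicDist_triangle Ω x w z).trans_lt (ENNReal.add_lt_top.2 ⟨hlt, ?_⟩)
    rw [intrinsicDist_comm]; exact h w hw
  obtain ⟨r, hr, hb, h⟩ := key x hx
  obtain ⟨z, -, hzA, hzB⟩ := hc A B oA oB (fun z hz => by
    by_cases h : intrinsicDist Ω x z < ⊤
    · exact Or.inl ⟨hz, h⟩
    · exact Or.inr ⟨hz, h⟩) ⟨x, hx, hx, h x (Metric.mem_ball_self hr)⟩ ⟨y, hy, hy, hcon⟩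
  exact hzB.2 hzA.2

/-- A compact subset of an open connected set has finite intrinsic diameter. -/
theorem exists_intrinsicDist_le_of_isCompact {n : ℕ} {Ω : Set (E n)} (hopen : IsOpen Ω)
    (hc : IsPreconnected Ω) {x : E n} (hx : x ∈ Ω) {K : Set (E n)} (hK : IsCompact K)
    (hKΩ : K ⊆ Ω) : ∃ M : ℝ≥0∞, M < ⊤ ∧ ∀ y ∈ K, intrinsicDist Ω x y ≤ M := by
  refine hK.induction_on (p := fun s => ∃ M : ℝ≥0∞, M < ⊤ ∧ ∀ y ∈ s, intrinsicDist Ω x y ≤ M)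
    ⟨0, by simp, by simp⟩ ?_ ?_ ?_
  · rintro s t hst ⟨M, hM, h⟩
    exact ⟨M, hM, fun y hy => h y (hst hy)⟩
  · rintro s t ⟨M, hM, h⟩ ⟨N, hN, h'⟩
    refine ⟨max M N, max_lt hM hN, ?_⟩
    rintro y (hy | hy)
    · exact (h y hy).trans (le_max_left _ _)
    · exact (h' y hy).trans (le_max_right _ _)
  · intro z hz
    obtain ⟨r, hr, hb⟩ := Metric.isOpen_iff.1 hopen z (hKΩ hz)
    refine ⟨Metric.ball z r, mem_nhdsWithin_of_mem_nhds (Metric.ball_mem_nhds z hr),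
      intrinsicDist Ω x z + ENNReal.ofReal r, ENNReal.add_lt_top.2
        ⟨intrinsicDist_lt_top hopen hc hx (hKΩ hz), ENNReal.ofReal_lt_top⟩, fun w hw => ?_⟩
    refine (intrinsicDist_triangle Ω x z w).trans ?_
    gcongr
    refine (intrinsicDist_le_edist_of_ball hb (Metric.mem_ball_self hr) hw).trans ?_
    rw [edist_comm, edist_dist]
    exact ENNReal.ofReal_le_ofReal (Metric.mem_ball.1 hw).le

/-! ### The cone condition and finiteness of the intrinsic diameter. -/

/-- The uniform interior cone condition at a point of the closure. -/
theorem HasLipschitzBoundary.exists_cone {n : ℕ} {Ω : Set (E n)} (hopen : IsOpen Ω)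
    (hLip : HasLipschitzBoundary Ω) {z : E n} (hz : z ∈ closure Ω) :
    ∃ r > 0, ∃ ν : E n, ‖ν‖ ≤ 1 ∧ ∀ x ∈ Ω ∩ Metric.ball z r, ∀ t : ℝ, 0 < t → t ≤ r →
      ∀ h : E n, ‖h - t • ν‖ ≤ r * t → x + h ∈ Ω := by
  by_cases hzΩ : z ∈ Ω
  · obtain ⟨ρ, hρ, hb⟩ := Metric.isOpen_iff.1 hopen z hzΩ
    have hr0 : 0 < min (ρ / 2) (1/2) := by positivity
    -- At an interior point the direction `0` will do: the cone degenerates to small balls about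
    -- `x`.
    refine ⟨min (ρ / 2) (1/2), hr0, 0, by simp, fun x hx t ht htr h hh => hb ?_⟩
    have hxz : ‖x - z‖ < min (ρ / 2) (1/2) := by simpa [dist_eq_norm] using hx.2
    simp only [smul_zero, sub_zero] at hh
    have h1 : ‖h‖ ≤ ρ / 2 := by
      refine hh.trans ?_
      have a1 : min (ρ / 2) (1/2) ≤ 1/2 := min_le_right _ _
      have a2 : min (ρ / 2) (1/2) ≤ ρ/2 := min_le_left _ _
      nlinarith
    have h2 : ‖x - z‖ < ρ / 2 := hxz.trans_le (min_le_left _ _)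
    rw [Metric.mem_ball, dist_eq_norm]
    calc ‖x + h - z‖ = ‖(x - z) + h‖ := by congr 1; abel
      _ ≤ ‖x - z‖ + ‖h‖ := norm_add_le _ _
      _ < ρ := by linarith
  · have hzf : z ∈ frontier Ω := by
      rw [hopen.frontier_eq]; exact ⟨hz, hzΩ⟩
    obtain ⟨ν, hν, k, g, hg, hev⟩ := hLip z hzf
    obtain ⟨ρ, hρ, hb⟩ := Metric.eventually_nhds_iff_ball.1 hev
    set P := (Submodule.span ℝ {ν})ᗮ.orthogonalProjectionOnto with hP
    have hk : (0:ℝ) ≤ k := k.2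
    -- The bound `ρ / 3` keeps `x + h` in the chart, since `‖h‖ ≤ 2 * r`. The bound `r * (k + 2) ≤
    -- 1` makes the gain `t - r * t` along `ν` outweigh the possible rise `k * (r * t)` of the
    -- graph.
    set r : ℝ := min (ρ / 3) (1 / (k + 2)) with hr
    have hr0 : 0 < r := by positivity
    have hr1 : r ≤ ρ / 3 := min_le_left _ _
    have hr2 : r * (k + 2) ≤ 1 := by
      have : r ≤ 1 / (k + 2) := min_le_right _ _
      rwa [le_div_iff₀ (by positivity)] at this
    have hPν : P ν = 0 := by
      apply Submodule.orthogonalProjectionOnto_apply_of_mem_orthogonal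
      rw [Submodule.orthogonal_orthogonal]
      exact Submodule.mem_span_singleton_self ν
    refine ⟨r, hr0, ν, hν.le, fun x hx t ht htr h hh => ?_⟩
    have hxz : ‖x - z‖ < r := by simpa [dist_eq_norm] using hx.2
    have hnh : ‖h‖ ≤ 2 * r := by
      have : ‖h‖ ≤ ‖h - t • ν‖ + ‖t • ν‖ := by
        simpa using norm_add_le (h - t • ν) (t • ν)
      rw [norm_smul, hν, Real.norm_of_nonneg ht.le] at this
      nlinarith
    have hxb : x ∈ Metric.ball z ρ := by
      rw [Metric.mem_ball, dist_eq_norm]; linarith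
    have hxhb : x + h ∈ Metric.ball z ρ := by
      rw [Metric.mem_ball, dist_eq_norm]
      calc ‖x + h - z‖ = ‖(x - z) + h‖ := by congr 1; abel
        _ ≤ ‖x - z‖ + ‖h‖ := norm_add_le _ _
        _ < ρ := by linarith
    have hgx := (hb x hxb).1 hx.1
    refine (hb _ hxhb).2 ?_
    have e1 : P h = P (h - t • ν) := by rw [map_sub, map_smul, hPν, smul_zero, sub_zero]
    have e2 : ‖P h‖ ≤ r * t := by
      rw [e1]
      exact (Submodule.norm_orthogonalProjectionOnto_apply_le _ _).trans hh
    have e3 : g (P (x + h)) ≤ g (P x) + k * (r * t) := by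
      have := hg.dist_le_mul (P (x + h)) (P x)
      rw [Real.dist_eq, dist_eq_norm, map_add, add_sub_cancel_left] at this
      have h4 := (abs_le.1 this).2
      rw [map_add]
      nlinarith
    have e4 : ⟪ν, x⟫ + t - r * t ≤ ⟪ν, x + h⟫ := by
      have h5 : ⟪ν, h⟫ = t + ⟪ν, h - t • ν⟫ := by
        rw [inner_sub_right, inner_smul_right, real_inner_self_eq_norm_sq, hν]; ring
      have h6 : |⟪ν, h - t • ν⟫| ≤ r * t := by
        refine (abs_real_inner_le_norm _ _).trans ?_
        rw [hν, one_mul]; exact hh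
      rw [inner_add_right, h5]
      have := (abs_le.1 h6).1
      linarith
    have : r * t * (k + 2) ≤ t := by nlinarith
    nlinarith [mul_pos hr0 ht]

/-- The uniform interior cone condition: finitely many balls cover `Ω`, and in each of them all
the points of `Ω` can be moved into `Ω` along a common cone. -/
theorem HasLipschitzBoundary.exists_cone_cover {n : ℕ} {Ω : Set (E n)} (hopen : IsOpen Ω)
    (hbdd : Bornology.IsBounded Ω) (hLip : HasLipschitzBoundary Ω) :
    ∃ (S : Finset (E n)) (r : E n → ℝ) (ν : E n → E n) (c : ℝ), 0 < c ∧ (∀ z, ‖ν z‖ ≤ 1) ∧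
      (∀ x ∈ Ω, ∃ z ∈ S, x ∈ Metric.ball z (r z)) ∧
      ∀ z ∈ S, ∀ x ∈ Ω ∩ Metric.ball z (r z), ∀ t : ℝ, 0 < t → t ≤ c →
        ∀ h : E n, ‖h - t • ν z‖ ≤ c * t → x + h ∈ Ω := by
  have key : ∀ z : E n, ∃ r > 0, ∃ ν : E n, ‖ν‖ ≤ 1 ∧ (z ∈ closure Ω →
      ∀ x ∈ Ω ∩ Metric.ball z r, ∀ t : ℝ, 0 < t → t ≤ r →
      ∀ h : E n, ‖h - t • ν‖ ≤ r * t → x + h ∈ Ω) := fun z => by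
    by_cases hz : z ∈ closure Ω
    · obtain ⟨r, hr, ν, hν, h⟩ := hLip.exists_cone hopen hz
      exact ⟨r, hr, ν, hν, fun _ => h⟩
    · exact ⟨1, one_pos, 0, by simp, fun h => absurd h hz⟩
  choose r hr ν hν h using key
  obtain ⟨S, hS, hcov⟩ := hbdd.isCompact_closure.elim_nhds_subcover
    (fun z => Metric.ball z (r z)) (fun z _ => Metric.ball_mem_nhds z (hr z))
  obtain ⟨c, hc0, hc⟩ : ∃ c > 0, ∀ z ∈ S, c ≤ r z := by
    rcases S.eq_empty_or_nonempty with rfl | hne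
    · exact ⟨1, one_pos, by simp⟩
    · obtain ⟨z, hz, hmin⟩ := S.exists_min_image r hne
      exact ⟨r z, hr z, hmin⟩
  refine ⟨S, r, ν, c, hc0, hν, fun x hx => ?_, fun z hz x hx t ht htc w hw => ?_⟩
  · simpa using hcov (subset_closure hx)
  · exact h z (hS z hz) x hx t ht (htc.trans (hc z hz)) w
      (hw.trans (mul_le_mul_of_nonneg_right (hc z hz) ht.le))

/-- Closed because the balls are open: a point of `ball y δ` lies in `ball x' δ` for every centre
`x'` close enough to `y`. These sets are the compact cores into which the cone condition pushes `Ω`.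
-/
theorem isCompact_setOf_ball_subset {n : ℕ} {Ω : Set (E n)} (hbdd : Bornology.IsBounded Ω)
    {δ : ℝ} (hδ : 0 < δ) : IsCompact {x | Metric.ball x δ ⊆ Ω} := by
  refine Metric.isCompact_of_isClosed_isBounded ?_
    (hbdd.subset fun x hx => hx (Metric.mem_ball_self hδ))
  refine isClosed_of_closure_subset fun x hx y hy => ?_
  obtain ⟨x', hx', hd⟩ := Metric.mem_closure_iff.1 hx (δ - dist y x) (by simpa using hy)
  refine hx' (Metric.mem_ball.2 ?_)
  linarith [dist_triangle y x x']

/-- Each point is joined, by a segment of length at most `c` inside its cone, to a point whose `c *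
c`-ball lies in `Ω`. Those endpoints form a compact set, which has bounded distance from `x₀`. -/
theorem intrinsicDiam_lt_top {n : ℕ} {Ω : Set (E n)} (hopen : IsOpen Ω)
    (hbdd : Bornology.IsBounded Ω) (hc : IsPreconnected Ω) (hLip : HasLipschitzBoundary Ω) :
    intrinsicDiam Ω < ⊤ := by
  rcases Ω.eq_empty_or_nonempty with rfl | ⟨x₀, hx₀⟩
  · simp [intrinsicDiam]
  obtain ⟨S, r, ν, c, hc0, hν, hcov, hcone⟩ := hLip.exists_cone_cover hopen hbdd
  obtain ⟨M, hM, hbound⟩ := exists_intrinsicDist_le_of_isCompact hopen hc hx₀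
    (isCompact_setOf_ball_subset hbdd (δ := c * c) (by positivity))
    (fun x hx => hx (Metric.mem_ball_self (by positivity)))
  have key : ∀ x ∈ Ω, intrinsicDist Ω x₀ x ≤ M + ENNReal.ofReal c := fun x hx => by
    obtain ⟨z, hz, hxz⟩ := hcov x hx
    have h1 : Metric.ball (x + c • ν z) (c * c) ⊆ Ω := fun y hy => by
      have := hcone z hz x ⟨hx, hxz⟩ c hc0 le_rfl (y - x) (by
        rw [Metric.mem_ball, dist_eq_norm] at hy
        rw [sub_sub]; exact hy.le)
      simpa using this
    have h2 : segment ℝ (x + c • ν z) x ⊆ Ω := by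
      rw [segment_symm, segment_eq_image']
      rintro _ ⟨s, hs, rfl⟩
      rcases hs.1.eq_or_lt with h0 | h0
      · simpa [← h0] using hx
      · simp only [add_sub_cancel_left]
        refine hcone z hz x ⟨hx, hxz⟩ (s * c) (by positivity) (by nlinarith [hs.2]) _ ?_
        rw [smul_smul, sub_self, norm_zero]; positivity
    refine (intrinsicDist_triangle Ω x₀ (x + c • ν z) x).trans ?_
    gcongr
    · exact hbound _ h1
    · refine (intrinsicDist_le_edist_of_segment_subset h2).trans ?_
      rw [edist_dist]
      apply ENNReal.ofReal_le_ofReal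
      rw [dist_eq_norm, add_sub_cancel_left, norm_smul, Real.norm_of_nonneg hc0.le]
      nlinarith [hν z]
  refine lt_of_le_of_lt (b := (M + ENNReal.ofReal c) + (M + ENNReal.ofReal c)) ?_
    (by simp [ENNReal.add_lt_top, hM])
  refine iSup₂_le fun x hx => iSup₂_le fun y hy => ?_
  refine (intrinsicDist_triangle Ω x x₀ y).trans ?_
  gcongr
  · rw [intrinsicDist_comm]; exact key x hx
  · exact key y hy

theorem intrinsicDiam_pos {n : ℕ} (hn : 1 ≤ n) {Ω : Set (E n)} (hopen : IsOpen Ω)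
    (hne : Ω.Nonempty) : 0 < intrinsicDiam Ω := by
  obtain ⟨x, hx⟩ := hne
  have : Nonempty (Fin n) := ⟨⟨0, hn⟩⟩
  have : Nontrivial (E n) := inferInstance
  have := Module.punctured_nhds_neBot ℝ (E n) x
  obtain ⟨y, hy, hyx⟩ := (Filter.inter_mem (mem_nhdsWithin_of_mem_nhds (hopen.mem_nhds hx) :
    Ω ∈ 𝓝[≠] x) self_mem_nhdsWithin) |> Filter.nonempty_of_mem
  refine (edist_pos.2 (Ne.symm hyx)).trans_le ((edist_le_intrinsicDist Ω x y).trans ?_)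
  exact le_iSup₂_of_le x hx (le_iSup₂_of_le y hy le_rfl)

/-! ### Oscillation along curves. -/

/-- A function that is locally `L`-Lipschitz at a uniform scale along a curve changes by at most
`L` times the length of the curve. -/
theorem edist_le_mul_eVariationOn {n : ℕ} {γ : ℝ → E n} (hγ : ContinuousOn γ (Icc 0 1))
    {f : E n → ℝ} {L : NNReal} {δ : ℝ} (hδ : 0 < δ)
    (hf : ∀ s ∈ Icc (0:ℝ) 1, ∀ y ∈ Metric.ball (γ s) δ, edist (f y) (f (γ s)) ≤ L * edist y (γ s)) :
    edist (f (γ 0)) (f (γ 1)) ≤ L * eVariationOn γ (Icc 0 1) := by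
  have huc := isCompact_Icc.uniformContinuousOn_of_continuous hγ
  obtain ⟨η, hη, hd⟩ := Metric.uniformContinuousOn_iff.1 huc δ hδ
  obtain ⟨N, hN⟩ := exists_nat_gt (1 / η)
  have hN0 : (0:ℝ) < N := lt_trans (by positivity) hN
  set u : ℕ → ℝ := fun i => min (i / N) 1 with hu
  have hmono : Monotone u := fun i j hij => by
    simp only [hu]; gcongr
  have hmem : ∀ i, u i ∈ Icc (0:ℝ) 1 := fun i =>
    ⟨le_min (by positivity) zero_le_one, min_le_right _ _⟩
  have h0 : u 0 = 0 := by simp [hu]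
  have h1 : u N = 1 := by simp [hu, div_self hN0.ne']
  have hstep : ∀ i, dist (u (i+1)) (u i) < η := fun i => by
    have : dist (u (i+1)) (u i) ≤ 1 / N := by
      rw [Real.dist_eq, abs_of_nonneg (sub_nonneg.2 (hmono (Nat.le_succ i)))]
      simp only [hu]
      push_cast
      rw [add_div]
      have : min ((i:ℝ)/N + 1/N) 1 ≤ min ((i:ℝ)/N) 1 + 1/N := by
        rw [← min_add_add_right]
        exact min_le_min le_rfl (by simp)
      linarith
    refine this.trans_lt ?_
    rw [div_lt_iff₀ hN0]
    rw [div_lt_iff₀ hη] at hN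
    linarith
  calc edist (f (γ 0)) (f (γ 1)) = edist (f (γ (u 0))) (f (γ (u N))) := by rw [h0, h1]
    _ ≤ ∑ i ∈ Finset.range N, edist (f (γ (u i))) (f (γ (u (i+1)))) :=
      edist_le_range_sum_edist (fun i => f (γ (u i))) N
    _ ≤ ∑ i ∈ Finset.range N, L * edist (γ (u (i+1))) (γ (u i)) := by
      gcongr with i _
      rw [edist_comm]
      exact hf _ (hmem i) _ (hd _ (hmem _) _ (hmem _) (hstep i))
    _ = L * ∑ i ∈ Finset.range N, edist (γ (u (i+1))) (γ (u i)) := by rw [Finset.mul_sum]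
    _ ≤ L * eVariationOn γ (Icc 0 1) := by
      gcongr
      exact eVariationOn.sum_le hmono hmem

/-- Uniform control of oscillations on a compact set by Lipschitz constants slightly inside `Ω`. -/
theorem exists_scale_dist_le {n : ℕ} {Ω : Set (E n)} (hopen : IsOpen Ω) {D : NNReal}
    (hD : intrinsicDiam Ω = D) {K : Set (E n)} (hK : IsCompact K) (hKΩ : K ⊆ Ω)
    {ε : ℝ} (hε : 0 < ε) :
    ∃ δ > 0, ∀ (f : E n → ℝ) (L : NNReal),
      (∀ x y, (∀ z ∈ segment ℝ x y, Metric.ball z δ ⊆ Ω) → dist (f x) (f y) ≤ L * dist x y) →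
      ∀ p ∈ K, ∀ q ∈ K, dist (f p) (f q) ≤ L * (D + ε) := by
  -- Stated for pairs, the claim is local on the compact set `K ×ˢ K` and stable under finite
  -- unions, by taking the smaller `δ`.
  suffices H : ∃ δ > 0, ∀ (f : E n → ℝ) (L : NNReal),
      (∀ x y, (∀ z ∈ segment ℝ x y, Metric.ball z δ ⊆ Ω) → dist (f x) (f y) ≤ L * dist x y) →
      ∀ w ∈ K ×ˢ K, dist (f w.1) (f w.2) ≤ L * (D + ε) by
    obtain ⟨δ, hδ, h⟩ := H
    exact ⟨δ, hδ, fun f L hf p hp q hq => h f L hf (p, q) ⟨hp, hq⟩⟩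
  refine (hK.prod hK).induction_on (p := fun s => ∃ δ > 0, ∀ (f : E n → ℝ) (L : NNReal),
      (∀ x y, (∀ z ∈ segment ℝ x y, Metric.ball z δ ⊆ Ω) → dist (f x) (f y) ≤ L * dist x y) →
      ∀ w ∈ s, dist (f w.1) (f w.2) ≤ L * (D + ε)) ⟨1, one_pos, by simp⟩ ?_ ?_ ?_
  · rintro s t hst ⟨δ, hδ, h⟩
    exact ⟨δ, hδ, fun f L hf w hw => h f L hf w (hst hw)⟩
  · rintro s t ⟨δ, hδ, h⟩ ⟨δ', hδ', h'⟩
    refine ⟨min δ δ', lt_min hδ hδ', fun f L hf w hw => ?_⟩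
    rcases hw with hw | hw
    · exact h f L (fun x y hxy => hf x y fun z hz =>
        (Metric.ball_subset_ball (min_le_left _ _)).trans (hxy z hz)) w hw
    · exact h' f L (fun x y hxy => hf x y fun z hz =>
        (Metric.ball_subset_ball (min_le_right _ _)).trans (hxy z hz)) w hw
  · rintro ⟨p, q⟩ ⟨hp, hq⟩
    have hlt : intrinsicDist Ω p q < D + ENNReal.ofReal (ε / 2) := by
      refine lt_of_le_of_lt (b := (D : ℝ≥0∞)) ?_ (ENNReal.lt_add_right (by simp) (by simpa using hε))
      rw [← hD]
      exact le_iSup₂_of_le p (hKΩ hp) (le_iSup₂_of_le q (hKΩ hq) le_rfl)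
    unfold intrinsicDist at hlt
    simp only [iInf_lt_iff] at hlt
    obtain ⟨γ, ⟨hγc, hγm, rfl, rfl⟩, hlen⟩ := hlt
    -- The curve has a tube of radius `ρ` in `Ω`. Half of it allows for moving off the curve, the
    -- other half for the `δ`-balls with `δ = ρ / 2`.
    obtain ⟨ρ, hρ, hsub⟩ := (isCompact_Icc.image_of_continuousOn hγc).exists_thickening_subset_open
      hopen hγm.image_subset
    have hball : ∀ s ∈ Icc (0:ℝ) 1, Metric.ball (γ s) ρ ⊆ Ω := fun s hs =>
      (Metric.ball_subset_thickening (mem_image_of_mem γ hs) ρ).trans hsub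
    have hseg : ∀ s ∈ Icc (0:ℝ) 1, ∀ y ∈ Metric.ball (γ s) (ρ / 2), ∀ z ∈ segment ℝ y (γ s),
        Metric.ball z (ρ / 2) ⊆ Ω := fun s hs y hy z hz => by
      have h1 : z ∈ Metric.ball (γ s) (ρ / 2) :=
        (convex_ball (γ s) (ρ / 2)).segment_subset hy (Metric.mem_ball_self (by positivity)) hz
      refine (Metric.ball_subset_ball' ?_).trans (hball s hs)
      linarith [Metric.mem_ball.1 h1]
    have h0 : (0:ℝ) ∈ Icc (0:ℝ) 1 := by simp
    have h1 : (1:ℝ) ∈ Icc (0:ℝ) 1 := by simp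
    -- Moving each endpoint costs `ε / 4` and the excess length of the curve `ε / 2`, which adds up
    -- to `ε`.
    have hr : 0 < min (ρ / 2) (ε / 4) := by positivity
    refine ⟨Metric.ball (γ 0) (min (ρ / 2) (ε / 4)) ×ˢ Metric.ball (γ 1) (min (ρ / 2) (ε / 4)),
      mem_nhdsWithin_of_mem_nhds (prod_mem_nhds (Metric.ball_mem_nhds _ hr)
        (Metric.ball_mem_nhds _ hr)), ρ / 2, by positivity, fun f L hf w hw => ?_⟩
    have hmid : dist (f (γ 0)) (f (γ 1)) ≤ L * (D + ε / 2) := by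
      have := edist_le_mul_eVariationOn hγc (f := f) (L := L) (δ := ρ / 2) (by positivity)
        (fun s hs y hy => by
          have := hf y (γ s) (hseg s hs y hy)
          rw [edist_dist, edist_dist, ← ENNReal.ofReal_coe_nnreal,
            ← ENNReal.ofReal_mul L.coe_nonneg]
          exact ENNReal.ofReal_le_ofReal this)
      have h2 : edist (f (γ 0)) (f (γ 1)) ≤ ENNReal.ofReal (L * (D + ε / 2)) := by
        refine this.trans ?_
        rw [ENNReal.ofReal_mul L.coe_nonneg, ENNReal.ofReal_add D.coe_nonneg (by positivity),
          ENNReal.ofReal_coe_nnreal, ENNReal.ofReal_coe_nnreal]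
        gcongr
      rw [edist_dist] at h2
      exact (ENNReal.ofReal_le_ofReal_iff (by positivity)).1 h2
    have hend : ∀ s ∈ Icc (0:ℝ) 1, ∀ y ∈ Metric.ball (γ s) (min (ρ / 2) (ε / 4)),
        dist (f y) (f (γ s)) ≤ L * (ε / 4) := fun s hs y hy => by
      refine (hf y (γ s) (hseg s hs y
        (Metric.ball_subset_ball (min_le_left _ _) hy))).trans ?_
      gcongr
      exact (Metric.mem_ball.1 hy).le.trans (min_le_right _ _)
    have e0 := hend 0 h0 w.1 hw.1
    have e1 := hend 1 h1 w.2 hw.2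
    calc dist (f w.1) (f w.2)
        ≤ dist (f w.1) (f (γ 0)) + dist (f (γ 0)) (f (γ 1)) + dist (f (γ 1)) (f w.2) :=
          dist_triangle4 _ _ _ _
      _ ≤ L * (ε / 4) + L * (D + ε / 2) + L * (ε / 4) := by
          rw [dist_comm (f (γ 1))]; gcongr
      _ = L * (D + ε) := by ring

/-! ### Mollification. -/

section Mollify

variable {n : ℕ} {F : Type*} [NormedAddCommGroup F] [NormedSpace ℝ F]

/-- The convolution of `f` with the normalized bump function `φ`. -/
noncomputable def mollify (φ : ContDiffBump (0 : E n)) (f : E n → F) : E n → F :=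
  MeasureTheory.convolution (φ.normed volume) f (ContinuousLinearMap.lsmul ℝ ℝ) volume

theorem mollify_apply (φ : ContDiffBump (0 : E n)) (f : E n → F) (x : E n) :
    mollify φ f x = ∫ t, φ.normed volume t • f (x - t) := rfl

theorem mollify_eq_integral_sub (φ : ContDiffBump (0 : E n)) (f : E n → F) (x : E n) :
    mollify φ f x = ∫ y, φ.normed volume (x - y) • f y :=
  MeasureTheory.convolution_lsmul_swap

theorem continuous_mollify (φ : ContDiffBump (0 : E n)) {f : E n → F}
    (hf : LocallyIntegrable f) : Continuous (mollify φ f) :=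
  φ.hasCompactSupport_normed.continuous_convolution_left _ φ.continuous_normed hf

theorem integrable_mollify_kernel (φ : ContDiffBump (0 : E n)) {f : E n → F}
    (hf : LocallyIntegrable f) (x : E n) :
    Integrable fun y => φ.normed volume (x - y) • f y :=
  φ.hasCompactSupport_normed.convolutionExists_right
    (ContinuousLinearMap.lsmul ℝ ℝ : ℝ →L[ℝ] F →L[ℝ] F).flip hf φ.continuous_normed x

theorem hasFDerivAt_mollify (φ : ContDiffBump (0 : E n)) {f : E n → ℝ}
    (hf : LocallyIntegrable f) (x : E n) :
    HasFDerivAt (mollify φ f) (fderiv ℝ (mollify φ f) x) x := by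
  have h : ContDiff ℝ (1 : ℕ∞) (mollify φ f) :=
    φ.hasCompactSupport_normed.contDiff_convolution_left _ φ.contDiff_normed hf
  exact (h.differentiable (by simp) x).hasFDerivAt

theorem fderiv_mollify_apply (φ : ContDiffBump (0 : E n)) {f : E n → ℝ}
    (hf : LocallyIntegrable f) (x e : E n) :
    fderiv ℝ (mollify φ f) x e = ∫ y, fderiv ℝ (φ.normed volume) (x - y) e * f y := by
  have h := φ.hasCompactSupport_normed (μ := volume).hasFDerivAt_convolution_left
    (ContinuousLinearMap.lsmul ℝ ℝ : ℝ →L[ℝ] ℝ →L[ℝ] ℝ)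
    (φ.contDiff_normed (n := 1)) hf x
  have h2 := h.fderiv
  change fderiv ℝ (mollify φ f) x = _ at h2
  rw [h2, convolution_eq_swap, ContinuousLinearMap.integral_apply]
  · rfl
  · refine convolutionExistsAt_iff_integrable_swap.1 ?_
    exact (φ.hasCompactSupport_normed.fderiv ℝ).convolutionExists_left _
      ((φ.contDiff_normed (n := 1)).continuous_fderiv (by simp)) hf x

/-- `G` is a weak gradient of `v` in `Ω`, for functions on the whole space. -/
def IsWeakGradient (Ω : Set (E n)) (v : E n → ℝ) (G : E n → E n) : Prop :=
  ∀ ψ : E n → ℝ, ContDiff ℝ ∞ ψ → HasCompactSupport ψ → tsupport ψ ⊆ Ω → ∀ e : E n,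
    ∫ x, v x * fderiv ℝ ψ x e = -∫ x, ⟪G x, e⟫ * ψ x

/-- The weak gradient identity is tested with the reflected kernel `y ↦ φ (x - y)`, supported in `Ω`
by `hx`; the sign from the reflection cancels the one from the integration by parts. -/
theorem IsWeakGradient.fderiv_mollify {Ω : Set (E n)} {v : E n → ℝ} {G : E n → E n}
    (h : IsWeakGradient Ω v G) (hv : LocallyIntegrable v) (hG : LocallyIntegrable G)
    (φ : ContDiffBump (0 : E n)) {x : E n} (hx : Metric.closedBall x φ.rOut ⊆ Ω) (e : E n) :
    fderiv ℝ (mollify φ v) x e = ⟪mollify φ G x, e⟫ := by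
  set ψ : E n → ℝ := fun y => φ.normed volume (x - y) with hψ
  have hψs : Function.support ψ ⊆ Metric.closedBall x φ.rOut := fun y hy => by
    have : x - y ∈ Function.support (φ.normed volume) := hy
    rw [φ.support_normed_eq, mem_ball_zero_iff] at this
    rw [Metric.mem_closedBall, dist_comm, dist_eq_norm]
    exact this.le
  have hψt : tsupport ψ ⊆ Metric.closedBall x φ.rOut :=
    closure_minimal hψs Metric.isClosed_closedBall
  have hψc : HasCompactSupport ψ :=
    (isCompact_closedBall x φ.rOut).of_isClosed_subset (isClosed_tsupport ψ) hψt
  have hψd : ContDiff ℝ ∞ ψ := φ.contDiff_normed.comp (contDiff_const.sub contDiff_id)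
  have hd : ∀ y, fderiv ℝ ψ y e = - fderiv ℝ (φ.normed volume) (x - y) e := fun y => by
    have h1 : HasFDerivAt (φ.normed volume) (fderiv ℝ (φ.normed volume) (x - y)) (x - y) :=
      (((φ.contDiff_normed (n := 1)).differentiable (by simp)) _).hasFDerivAt
    have h2 : HasFDerivAt ψ _ y := h1.comp y ((hasFDerivAt_id y).const_sub x)
    rw [h2.fderiv]; simp
  have key := h ψ hψd hψc (hψt.trans hx) e
  rw [fderiv_mollify_apply φ hv]
  calc ∫ y, fderiv ℝ (φ.normed volume) (x - y) e * v y
      = - ∫ y, v y * fderiv ℝ ψ y e := by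
        rw [← integral_neg]; congr 1; ext y; rw [hd]; ring
    _ = ∫ y, ⟪G y, e⟫ * ψ y := by rw [key, neg_neg]
    _ = ∫ y, ⟪e, φ.normed volume (x - y) • G y⟫ := by
        congr 1; ext y; rw [inner_smul_right, real_inner_comm, mul_comm]
    _ = ⟪e, mollify φ G x⟫ := by
        rw [mollify_eq_integral_sub, integral_inner (integrable_mollify_kernel φ hG x)]
    _ = ⟪mollify φ G x, e⟫ := real_inner_comm _ _

/-- Jensen's inequality, from the monotonicity of `L^p` norms on a probability space. -/
theorem enorm_integral_rpow_le {α : Type*} [MeasurableSpace α] {μ : Measure α}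
    [IsProbabilityMeasure μ] {f : α → F} (hf : AEStronglyMeasurable f μ) {p : ℝ} (hp : 1 ≤ p) :
    ‖∫ x, f x ∂μ‖ₑ ^ p ≤ ∫⁻ x, ‖f x‖ₑ ^ p ∂μ := by
  have hp0 : 0 < p := by linarith
  have h := eLpNorm'_le_eLpNorm'_of_exponent_le one_pos hp μ hf
  simp only [eLpNorm', ENNReal.rpow_one, div_one] at h
  calc ‖∫ x, f x ∂μ‖ₑ ^ p ≤ (∫⁻ x, ‖f x‖ₑ ∂μ) ^ p := by
        gcongr; exact enorm_integral_le_lintegral_enorm f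
    _ ≤ ((∫⁻ x, ‖f x‖ₑ ^ p ∂μ) ^ (1 / p)) ^ p := by gcongr
    _ = ∫⁻ x, ‖f x‖ₑ ^ p ∂μ := by
        rw [← ENNReal.rpow_mul, one_div_mul_cancel hp0.ne', ENNReal.rpow_one]

/-- The probability measure whose density is the normalized bump function `φ`. -/
noncomputable def bumpMeasure (φ : ContDiffBump (0 : E n)) : Measure (E n) :=
  volume.withDensity fun t => ENNReal.ofReal (φ.normed volume t)

instance isProbabilityMeasure_bumpMeasure (φ : ContDiffBump (0 : E n)) :
    IsProbabilityMeasure (bumpMeasure φ) := ⟨by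
  rw [bumpMeasure, withDensity_apply _ MeasurableSet.univ, Measure.restrict_univ,
    ← ofReal_integral_eq_lintegral_ofReal φ.integrable_normed
      (Eventually.of_forall φ.nonneg_normed), φ.integral_normed, ENNReal.ofReal_one]⟩

theorem measurable_ofReal_normed (φ : ContDiffBump (0 : E n)) :
    Measurable fun t => ENNReal.ofReal (φ.normed volume t) :=
  φ.continuous_normed.measurable.ennreal_ofReal

theorem lintegral_bumpMeasure (φ : ContDiffBump (0 : E n)) {f : E n → ℝ≥0∞} (hf : Measurable f) :
    ∫⁻ t, f t ∂(bumpMeasure φ) = ∫⁻ t, ENNReal.ofReal (φ.normed volume t) * f t := by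
  rw [bumpMeasure, lintegral_withDensity_eq_lintegral_mul _ (measurable_ofReal_normed φ) hf]
  rfl

theorem mollify_eq_integral_bumpMeasure (φ : ContDiffBump (0 : E n)) (f : E n → F) (x : E n) :
    mollify φ f x = ∫ t, f (x - t) ∂(bumpMeasure φ) := by
  rw [bumpMeasure, integral_withDensity_eq_integral_toReal_smul (measurable_ofReal_normed φ)
    (by simp), mollify_apply]
  congr 1; ext t
  rw [ENNReal.toReal_ofReal (φ.nonneg_normed t)]

theorem integrable_comp_sub_bumpMeasure (φ : ContDiffBump (0 : E n)) {f : E n → F}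
    (hf : LocallyIntegrable f) (x : E n) :
    Integrable (fun t => f (x - t)) (bumpMeasure φ) := by
  rw [bumpMeasure, integrable_withDensity_iff_integrable_smul' (measurable_ofReal_normed φ)
    (by simp)]
  have := (integrable_mollify_kernel φ hf x).comp_sub_left x
  refine this.congr (Eventually.of_forall fun t => ?_)
  simp only [sub_sub_cancel]
  rw [ENNReal.toReal_ofReal (φ.nonneg_normed t)]

theorem ae_bumpMeasure_norm_lt (φ : ContDiffBump (0 : E n)) :
    ∀ᵐ t ∂(bumpMeasure φ), ‖t‖ < φ.rOut := by
  rw [bumpMeasure, ae_withDensity_iff (measurable_ofReal_normed φ)]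
  refine Eventually.of_forall fun t ht => ?_
  have : t ∈ Function.support (φ.normed volume) := fun h0 => ht (by rw [h0, ENNReal.ofReal_zero])
  rwa [φ.support_normed_eq, mem_ball_zero_iff] at this

variable [MeasurableSpace F] [BorelSpace F] [SecondCountableTopology F]

theorem enorm_mollify_rpow_le (φ : ContDiffBump (0 : E n)) {f : E n → F} (hf : Measurable f)
    {p : ℝ} (hp : 1 ≤ p) (x : E n) :
    ‖mollify φ f x‖ₑ ^ p ≤ ∫⁻ t, ‖f (x - t)‖ₑ ^ p ∂(bumpMeasure φ) := by
  rw [mollify_eq_integral_bumpMeasure]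
  exact enorm_integral_rpow_le
    (hf.comp (measurable_const.sub measurable_id)).aestronglyMeasurable hp

theorem lintegral_enorm_mollify_rpow_le (φ : ContDiffBump (0 : E n)) {f : E n → F}
    (hf : Measurable f) {p : ℝ} (hp : 1 ≤ p) :
    ∫⁻ x, ‖mollify φ f x‖ₑ ^ p ≤ ∫⁻ x, ‖f x‖ₑ ^ p := by
  calc ∫⁻ x, ‖mollify φ f x‖ₑ ^ p
      ≤ ∫⁻ x, ∫⁻ t, ‖f (x - t)‖ₑ ^ p ∂(bumpMeasure φ) :=
        lintegral_mono fun x => enorm_mollify_rpow_le φ hf hp x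
    _ = ∫⁻ t, (∫⁻ x, ‖f (x - t)‖ₑ ^ p) ∂(bumpMeasure φ) := by
        refine lintegral_lintegral_swap (Measurable.aemeasurable ?_)
        exact (hf.comp (measurable_fst.sub measurable_snd)).enorm.pow_const p
    _ = ∫⁻ t, (∫⁻ x, ‖f x‖ₑ ^ p) ∂(bumpMeasure φ) := by
        congr 1; ext t
        exact lintegral_sub_right_eq_self (fun x => ‖f x‖ₑ ^ p) t
    _ = ∫⁻ x, ‖f x‖ₑ ^ p := by simp

/-- The source of uniformity in `p`: `B` depends on the bump alone, so after the `p`-th root only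
the factor `B ^ (1 / p)`, which tends to `1`, remains. -/
theorem enorm_mollify_rpow_le_mul (φ : ContDiffBump (0 : E n)) {f : E n → F} (hf : Measurable f)
    {p : ℝ} (hp : 1 ≤ p) {B : ℝ} (hB : ∀ t, φ.normed volume t ≤ B) (x : E n) :
    ‖mollify φ f x‖ₑ ^ p ≤ ENNReal.ofReal B * ∫⁻ t, ‖f t‖ₑ ^ p := by
  have hm : Measurable fun t => ‖f (x - t)‖ₑ ^ p :=
    (hf.comp (measurable_const.sub measurable_id)).enorm.pow_const p
  refine (enorm_mollify_rpow_le φ hf hp x).trans ?_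
  rw [lintegral_bumpMeasure φ hm]
  calc _ ≤ ∫⁻ t, ENNReal.ofReal B * ‖f (x - t)‖ₑ ^ p :=
        lintegral_mono fun t => by gcongr; exact hB t
    _ = _ := by
        rw [lintegral_const_mul _ hm]
        congr 1
        exact lintegral_sub_left_eq_self (fun t => ‖f t‖ₑ ^ p) x

end Mollify

/-! ### Difference estimates for Sobolev functions. -/

section Estimates

variable {n : ℕ} {Ω : Set (E n)} {v : E n → ℝ} {G : E n → E n}

/-- A bound of the mollified weak gradient gives a Lipschitz bound along segments. -/
theorem IsWeakGradient.dist_mollify_le (h : IsWeakGradient Ω v G) (hv : LocallyIntegrable v)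
    (hG : LocallyIntegrable G) (φ : ContDiffBump (0 : E n)) {δ : ℝ} (hδ : φ.rOut < δ) {L : ℝ}
    (hL : ∀ x, ‖mollify φ G x‖ ≤ L) {x y : E n}
    (hxy : ∀ z ∈ segment ℝ x y, Metric.ball z δ ⊆ Ω) :
    dist (mollify φ v x) (mollify φ v y) ≤ L * dist x y := by
  rw [dist_comm, dist_eq_norm, dist_comm, dist_eq_norm]
  refine (convex_segment x y).norm_image_sub_le_of_norm_hasFDerivWithin_le
    (fun z _ => (hasFDerivAt_mollify φ hv z).hasFDerivWithinAt) (fun z hz => ?_)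
    (left_mem_segment ℝ x y) (right_mem_segment ℝ x y)
  refine ContinuousLinearMap.opNorm_le_bound _ ((norm_nonneg _).trans (hL z)) fun e => ?_
  rw [h.fderiv_mollify hv hG φ ((Metric.closedBall_subset_ball hδ).trans (hxy z hz))]
  refine (norm_inner_le_norm _ _).trans ?_
  gcongr
  exact hL z

/-- The fundamental theorem of calculus along the segment from `x` to `x + w`, then Jensen on `(0,
1]`. -/
theorem IsWeakGradient.enorm_mollify_sub_rpow_le (h : IsWeakGradient Ω v G)
    (hv : LocallyIntegrable v) (hG : LocallyIntegrable G) (φ : ContDiffBump (0 : E n)) {p : ℝ}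
    (hp : 1 ≤ p) {x w : E n}
    (hx : ∀ s ∈ Icc (0:ℝ) 1, Metric.closedBall (x + s • w) φ.rOut ⊆ Ω) :
    ‖mollify φ v (x + w) - mollify φ v x‖ₑ ^ p ≤
      ‖w‖ₑ ^ p * ∫⁻ s in Ioc (0:ℝ) 1, ‖mollify φ G (x + s • w)‖ₑ ^ p := by
  have hp0 : 0 ≤ p := by linarith
  have hGc := continuous_mollify φ hG
  have hcont : Continuous fun s : ℝ => ⟪mollify φ G (x + s • w), w⟫ := by fun_prop
  have hint := intervalIntegral.integral_eq_sub_of_hasDerivAt (a := (0:ℝ)) (b := 1)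
    (f := fun s => mollify φ v (x + s • w)) (f' := fun s => ⟪mollify φ G (x + s • w), w⟫)
    (fun s hs => by
      rw [uIcc_of_le zero_le_one] at hs
      have h1 : HasDerivAt (fun s : ℝ => x + s • w) w s := by
        simpa using ((hasDerivAt_id s).smul_const w).const_add x
      rw [← h.fderiv_mollify hv hG φ (hx s hs)]
      exact (hasFDerivAt_mollify φ hv (x + s • w)).comp_hasDerivAt s h1)
    (hcont.intervalIntegrable 0 1)
  simp only [one_smul, zero_smul, add_zero] at hint
  rw [← hint, intervalIntegral.integral_of_le zero_le_one]
  have : IsProbabilityMeasure (volume.restrict (Ioc (0:ℝ) 1)) := ⟨by simp⟩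
  refine (enorm_integral_rpow_le hcont.aestronglyMeasurable hp).trans ?_
  rw [← lintegral_const_mul]
  · refine lintegral_mono fun s => ?_
    rw [← ENNReal.mul_rpow_of_nonneg _ _ hp0]
    gcongr
    rw [mul_comm, ← ofReal_norm, ← ofReal_norm, ← ofReal_norm,
      ← ENNReal.ofReal_mul (norm_nonneg _)]
    exact ENNReal.ofReal_le_ofReal (norm_inner_le_norm _ _)
  · have : Continuous fun s : ℝ => mollify φ G (x + s • w) := by fun_prop
    exact this.measurable.enorm.pow_const p

theorem le_liminf_of_tendsto_of_eventually_le {a b : ℕ → ℝ≥0∞} {l : ℝ≥0∞}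
    (ha : Tendsto a atTop (𝓝 l)) (hab : ∀ᶠ k in atTop, a k ≤ b k) : l ≤ liminf b atTop :=
  ha.liminf_eq.symm.trans_le (liminf_le_liminf hab)

/-- Comparable inner and outer radii are what the Lebesgue differentiation theorem needs for a.e.
convergence of the mollifications. -/
theorem exists_bump_seq (n : ℕ) : ∃ φ : ℕ → ContDiffBump (0 : E n),
    Tendsto (fun k => (φ k).rOut) atTop (𝓝 0) ∧ ∀ k, (φ k).rOut ≤ 2 * (φ k).rIn := by
  refine ⟨fun k => ⟨1 / ((k:ℝ) + 1), 2 / ((k:ℝ) + 1), by positivity, by gcongr; norm_num⟩, ?_,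
    fun k => by rw [mul_one_div]⟩
  have := (tendsto_one_div_add_atTop_nhds_zero_nat (𝕜 := ℝ)).const_mul 2
  simpa only [mul_one_div, mul_zero] using this

/-- The `L^p` estimate of the difference of a Sobolev function and its translate. -/
theorem IsWeakGradient.lintegral_enorm_translate_sub_le (h : IsWeakGradient Ω v G)
    (hopen : IsOpen Ω) (hv : LocallyIntegrable v) (hG : LocallyIntegrable G) (hGm : Measurable G)
    {p : ℝ} (hp : 1 ≤ p) {A : Set (E n)} (hA : MeasurableSet A) {w : E n}
    (hAw : ∀ x ∈ A, ∀ s ∈ Icc (0:ℝ) 1, x + s • w ∈ Ω) :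
    ∫⁻ x in A, ‖v (x + w) - v x‖ₑ ^ p ≤ ‖w‖ₑ ^ p * ∫⁻ x, ‖G x‖ₑ ^ p := by
  have hp0 : 0 ≤ p := by linarith
  obtain ⟨φ, hφ, hφ2⟩ := exists_bump_seq n
  have hae : ∀ᵐ x, Tendsto (fun k => mollify (φ k) v x) atTop (𝓝 (v x)) :=
    ContDiffBump.ae_convolution_tendsto_right_of_locallyIntegrable (K := 2) hφ
      (Eventually.of_forall hφ2) hv
  have hae' : ∀ᵐ x, Tendsto (fun k => mollify (φ k) v (x + w)) atTop (𝓝 (v (x + w))) :=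
    (measurePreserving_add_right volume w).quasiMeasurePreserving.ae hae
  set H : ℕ → E n → ℝ≥0∞ := fun k x =>
    ‖w‖ₑ ^ p * ∫⁻ s in Ioc (0:ℝ) 1, ‖mollify (φ k) G (x + s • w)‖ₑ ^ p with hH
  have hGc : ∀ k, Continuous (mollify (φ k) G) := fun k => continuous_mollify _ hG
  have hm2 : ∀ k, Measurable fun q : E n × ℝ => ‖mollify (φ k) G (q.1 + q.2 • w)‖ₑ ^ p :=
    fun k => by
      have : Continuous fun q : E n × ℝ => mollify (φ k) G (q.1 + q.2 • w) :=
        (hGc k).comp (by fun_prop)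
      exact this.measurable.enorm.pow_const p
  have hHm : ∀ k, Measurable (H k) := fun k => (hm2 k).lintegral_prod_right'.const_mul _
  have hHint : ∀ k, ∫⁻ x in A, H k x ≤ ‖w‖ₑ ^ p * ∫⁻ x, ‖G x‖ₑ ^ p := fun k => by
    calc ∫⁻ x in A, H k x ≤ ∫⁻ x, H k x := setLIntegral_le_lintegral _ _
      _ = ‖w‖ₑ ^ p * ∫⁻ x, ∫⁻ s in Ioc (0:ℝ) 1, ‖mollify (φ k) G (x + s • w)‖ₑ ^ p :=
          lintegral_const_mul _ (hm2 k).lintegral_prod_right'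
      _ = ‖w‖ₑ ^ p * ∫⁻ s in Ioc (0:ℝ) 1, ∫⁻ x, ‖mollify (φ k) G (x + s • w)‖ₑ ^ p := by
          rw [lintegral_lintegral_swap (hm2 k).aemeasurable]
      _ = ‖w‖ₑ ^ p * ∫⁻ s in Ioc (0:ℝ) 1, ∫⁻ x, ‖mollify (φ k) G x‖ₑ ^ p := by
          congr 2; ext s
          exact lintegral_add_right_eq_self (fun x => ‖mollify (φ k) G x‖ₑ ^ p) (s • w)
      _ = ‖w‖ₑ ^ p * ∫⁻ x, ‖mollify (φ k) G x‖ₑ ^ p := by simp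
      _ ≤ _ := mul_le_mul_right (lintegral_enorm_mollify_rpow_le (φ k) hGm hp) _
  -- The smoothed estimate holds only once `k` is large depending on `x`, when the compact segment
  -- has a tube of radius `(φ k).rOut` in `Ω`. Fatou's lemma absorbs this lack of uniformity.
  have hpt : ∀ᵐ x ∂(volume.restrict A),
      ‖v (x + w) - v x‖ₑ ^ p ≤ liminf (fun k => H k x) atTop := by
    filter_upwards [ae_restrict_of_ae hae, ae_restrict_of_ae hae', ae_restrict_mem hA]
      with x hx hx' hxA
    have hlim : Tendsto (fun k => ‖mollify (φ k) v (x + w) - mollify (φ k) v x‖ₑ ^ p) atTop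
        (𝓝 (‖v (x + w) - v x‖ₑ ^ p)) :=
      (hx'.sub hx).enorm.ennrpow_const p
    refine le_liminf_of_tendsto_of_eventually_le hlim ?_
    have hcomp : IsCompact ((fun s : ℝ => x + s • w) '' Icc 0 1) :=
      isCompact_Icc.image (by fun_prop)
    obtain ⟨ρ, hρ, hsub⟩ := hcomp.exists_thickening_subset_open hopen
      (image_subset_iff.2 fun s hs => hAw x hxA s hs)
    filter_upwards [hφ.eventually_lt_const hρ] with k hk
    refine h.enorm_mollify_sub_rpow_le hv hG (φ k) hp fun s hs => ?_
    have hmem : x + s • w ∈ (fun s : ℝ => x + s • w) '' Icc 0 1 := ⟨s, hs, rfl⟩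
    exact (Metric.closedBall_subset_ball hk).trans
      ((Metric.ball_subset_thickening hmem ρ).trans hsub)
  calc ∫⁻ x in A, ‖v (x + w) - v x‖ₑ ^ p
      ≤ ∫⁻ x in A, liminf (fun k => H k x) atTop := lintegral_mono_ae hpt
    _ ≤ liminf (fun k => ∫⁻ x in A, H k x) atTop := lintegral_liminf_le hHm
    _ ≤ _ := liminf_le_of_le (by isBoundedDefault) fun b hb => by
        obtain ⟨k, hk⟩ := hb.exists
        exact hk.trans (hHint k)

end Estimates

/-- The constant is the midpoint of the range. This halving is the origin of the `2` in `2 / D`. -/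
theorem exists_abs_sub_le_half {α : Type*} {K : Set α} (f : α → ℝ) {M : ℝ}
    (h : ∀ x ∈ K, ∀ y ∈ K, dist (f x) (f y) ≤ M) : ∃ a : ℝ, ∀ x ∈ K, |f x - a| ≤ M / 2 := by
  rcases K.eq_empty_or_nonempty with rfl | ⟨x₀, hx₀⟩
  · exact ⟨0, by simp⟩
  have hne : (f '' K).Nonempty := ⟨_, mem_image_of_mem f hx₀⟩
  have hle : ∀ x ∈ K, ∀ y ∈ K, f x ≤ f y + M := fun x hx y hy => by
    have := (abs_le.1 (h x hx y hy)).2; linarith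
  have hab : BddAbove (f '' K) := ⟨f x₀ + M, by rintro _ ⟨x, hx, rfl⟩; exact hle x hx x₀ hx₀⟩
  have hbb : BddBelow (f '' K) := ⟨f x₀ - M, by
    rintro _ ⟨x, hx, rfl⟩; linarith [hle x₀ hx₀ x hx]⟩
  have h1 : sSup (f '' K) ≤ sInf (f '' K) + M := csSup_le hne <| by
    rintro _ ⟨x, hx, rfl⟩
    have : f x - M ≤ sInf (f '' K) := le_csInf hne <| by
      rintro _ ⟨y, hy, rfl⟩; linarith [hle x hx y hy]
    linarith
  refine ⟨(sSup (f '' K) + sInf (f '' K)) / 2, fun x hx => ?_⟩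
  have h2 := le_csSup hab (mem_image_of_mem f hx)
  have h3 := csInf_le hbb (mem_image_of_mem f hx)
  rw [abs_le]; constructor <;> linarith

/-! ### The almost sharp Poincaré inequality. -/

section Core

variable {n : ℕ} {Ω : Set (E n)} {v : E n → ℝ} {G : E n → E n}

theorem eLpNorm_ofReal_rpow {α F : Type*} [MeasurableSpace α] [NormedAddCommGroup F]
    {μ : Measure α} (f : α → F) {p : ℝ} (hp : 1 ≤ p) :
    eLpNorm f (ENNReal.ofReal p) μ ^ p = ∫⁻ x, ‖f x‖ₑ ^ p ∂μ := by
  have hp0 : 0 < p := by linarith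
  rw [eLpNorm_eq_lintegral_rpow_enorm_toReal (by simpa using hp0) (by simp),
    ENNReal.toReal_ofReal hp0.le, ← ENNReal.rpow_mul, one_div_mul_cancel hp0.ne',
    ENNReal.rpow_one]

/-- A Sobolev function is close in `L^p`, on a patch with the cone condition, to the translate of
its mollification. -/
theorem IsWeakGradient.lintegral_enorm_mollify_translate_sub_le (h : IsWeakGradient Ω v G)
    (hopen : IsOpen Ω) (hv : LocallyIntegrable v) (hvm : Measurable v) (hG : LocallyIntegrable G)
    (hGm : Measurable G) {p : ℝ} (hp : 1 ≤ p) {A : Set (E n)} (hA : MeasurableSet A) {u : E n}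
    {φ : ContDiffBump (0 : E n)} {R : ℝ} (hR : ‖u‖ + φ.rOut ≤ R)
    (hcone : ∀ x ∈ A, ∀ τ : E n, ‖τ‖ < φ.rOut → ∀ s ∈ Icc (0:ℝ) 1, x + s • (u - τ) ∈ Ω) :
    ∫⁻ x in A, ‖mollify φ v (x + u) - v x‖ₑ ^ p ≤ ENNReal.ofReal R ^ p * ∫⁻ x, ‖G x‖ₑ ^ p := by
  have hp0 : 0 ≤ p := by linarith
  have hpt : ∀ x, ‖mollify φ v (x + u) - v x‖ₑ ^ p ≤
      ∫⁻ τ, ‖v (x + (u - τ)) - v x‖ₑ ^ p ∂(bumpMeasure φ) := fun x => by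
    have hi := integrable_comp_sub_bumpMeasure φ hv (x + u)
    have : mollify φ v (x + u) - v x = ∫ τ, (v (x + (u - τ)) - v x) ∂(bumpMeasure φ) := by
      simp only [← add_sub_assoc]
      rw [integral_sub hi (integrable_const _), mollify_eq_integral_bumpMeasure]
      simp
    rw [this]
    refine enorm_integral_rpow_le (Measurable.aestronglyMeasurable ?_) hp
    fun_prop
  calc ∫⁻ x in A, ‖mollify φ v (x + u) - v x‖ₑ ^ p
      ≤ ∫⁻ x in A, ∫⁻ τ, ‖v (x + (u - τ)) - v x‖ₑ ^ p ∂(bumpMeasure φ) :=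
        lintegral_mono fun x => hpt x
    _ = ∫⁻ τ, (∫⁻ x in A, ‖v (x + (u - τ)) - v x‖ₑ ^ p) ∂(bumpMeasure φ) := by
        refine lintegral_lintegral_swap (Measurable.aemeasurable ?_)
        fun_prop
    _ ≤ ∫⁻ _, (ENNReal.ofReal R ^ p * ∫⁻ x, ‖G x‖ₑ ^ p) ∂(bumpMeasure φ) := by
        refine lintegral_mono_ae ?_
        filter_upwards [ae_bumpMeasure_norm_lt φ] with τ hτ
        refine (h.lintegral_enorm_translate_sub_le hopen hv hG hGm hp hA
          (fun x hx => hcone x hx τ hτ)).trans ?_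
        gcongr
        rw [← ofReal_norm]
        apply ENNReal.ofReal_le_ofReal
        linarith [norm_sub_le u τ]
    _ = _ := by simp

/-- The sharp Poincaré inequality, up to `ε`, with a constant that tends to the half of the
intrinsic diameter as `p → ∞`. -/
theorem exists_poincare (hopen : IsOpen Ω) (hbdd : Bornology.IsBounded Ω)
    (hLip : HasLipschitzBoundary Ω) {D : NNReal} (hD : intrinsicDiam Ω = D) {ε : ℝ}
    (hε : 0 < ε) :
    ∃ Q : ℝ, 0 < Q ∧ ∀ (p : ℝ) (v : E n → ℝ) (G : E n → E n), 1 ≤ p → Measurable v →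
      Measurable G → LocallyIntegrable v → LocallyIntegrable G → IsWeakGradient Ω v G →
      eLpNorm G (ENNReal.ofReal p) ≠ ⊤ →
      ∃ a : ℝ, eLpNorm (fun x => v x - a) (ENNReal.ofReal p) (volume.restrict Ω) ≤
        ENNReal.ofReal ((D + ε) / 2 * Q ^ (1 / p) + ε) * eLpNorm G (ENNReal.ofReal p) := by
  obtain ⟨S, r, ν, c, hc0, hν, hcov, hcone⟩ := hLip.exists_cone_cover hopen hbdd
  -- Each of the `S.card` patches will contribute a translation error `2 * t * ‖G‖_p`.
  obtain ⟨t, ht0, htc, htε⟩ : ∃ t : ℝ, 0 < t ∧ t ≤ c ∧ S.card * (2 * t) ≤ ε := by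
    refine ⟨min c (ε / (2 * (S.card + 1))), by positivity, min_le_left _ _, ?_⟩
    have h1 : min c (ε / (2 * (S.card + 1))) ≤ ε / (2 * (S.card + 1)) := min_le_right _ _
    have h2 : (0:ℝ) < 2 * (S.card + 1) := by positivity
    rw [le_div_iff₀ h2] at h1
    have h3 : 0 < min c (ε / (2 * (S.card + 1))) := by positivity
    nlinarith
  have hct : 0 < c * t := by positivity
  set K : Set (E n) := {x | Metric.ball x (c * t) ⊆ Ω} with hK
  obtain ⟨δ, hδ0, hδ⟩ := exists_scale_dist_le hopen hD (isCompact_setOf_ball_subset hbdd hct)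
    (fun x hx => hx (Metric.mem_ball_self hct)) hε
  -- The scale is fixed before `p`: below `δ` for the Lipschitz bound on segments, at most `c * t`
  -- to stay inside the cones, at most `t` so that all displacements have norm at most `2 * t`.
  obtain ⟨φ, hφδ, hφc, hφt⟩ : ∃ φ : ContDiffBump (0 : E n),
      φ.rOut < δ ∧ φ.rOut ≤ c * t ∧ φ.rOut ≤ t := by
    have hm : 0 < min (δ / 2) (min (c * t) t) := by positivity
    refine ⟨⟨min (δ / 2) (min (c * t) t) / 2, min (δ / 2) (min (c * t) t), by positivity,
      by linarith⟩, ?_, ?_, ?_⟩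
    · exact (min_le_left _ _).trans_lt (by linarith)
    · exact (min_le_right _ _).trans (min_le_left _ _)
    · exact (min_le_right _ _).trans (min_le_right _ _)
  obtain ⟨B, hB0, hB⟩ : ∃ B : ℝ, 0 < B ∧ ∀ x, φ.normed volume x ≤ B := by
    obtain ⟨B, hB⟩ := φ.hasCompactSupport_normed.exists_bound_of_continuous
      (φ.continuous_normed (μ := volume))
    exact ⟨max B 1, by positivity, fun x =>
      ((le_abs_self _).trans (hB x)).trans (le_max_left _ _)⟩
  have hvol : volume Ω ≠ ⊤ := hbdd.measure_lt_top.ne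
  -- The summand `1` keeps the constant positive even if `Ω` is null.
  refine ⟨B * ((volume Ω).toReal + 1), by positivity,
    fun p v G hp hvm hGm hv hG hw hGfin => ?_⟩
  have hp0 : 0 < p := by linarith
  set g := eLpNorm G (ENNReal.ofReal p) with hg
  set V := mollify φ v with hV
  set L : NNReal := (ENNReal.ofReal B ^ (1 / p) * g).toNNReal with hL
  have hLtop : ENNReal.ofReal B ^ (1 / p) * g ≠ ⊤ :=
    ENNReal.mul_ne_top (ENNReal.rpow_ne_top_of_nonneg (by positivity) (by simp)) hGfin
  have hLbound : ∀ x, ‖mollify φ G x‖ ≤ L := fun x => by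
    have h1 := enorm_mollify_rpow_le_mul φ hGm hp hB x
    rw [← eLpNorm_ofReal_rpow G hp] at h1
    have h2 : ‖mollify φ G x‖ₑ ≤ ENNReal.ofReal B ^ (1 / p) * g := by
      rw [← ENNReal.rpow_le_rpow_iff hp0]
      refine h1.trans_eq ?_
      rw [ENNReal.mul_rpow_of_nonneg _ _ hp0.le, ← ENNReal.rpow_mul,
        one_div_mul_cancel hp0.ne', ENNReal.rpow_one]
    have h3 := ENNReal.toNNReal_mono hLtop h2
    rw [toNNReal_enorm] at h3
    exact NNReal.coe_le_coe.2 h3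
  obtain ⟨a, ha⟩ := exists_abs_sub_le_half (K := K) V
    (fun x hx y hy => hδ V L (fun x y hxy => hw.dist_mollify_le hv hG φ hφδ hLbound hxy)
      x hx y hy)
  refine ⟨a, ?_⟩
  set A : E n → Set (E n) := fun z => Ω ∩ Metric.ball z (r z) with hA
  have hAm : ∀ z, MeasurableSet (A z) := fun z =>
    hopen.measurableSet.inter Metric.isOpen_ball.measurableSet
  have hconv : ∀ z ∈ S, ∀ x ∈ A z, ∀ τ : E n, ‖τ‖ ≤ c * t → ∀ s ∈ Icc (0:ℝ) 1,
      x + s • (t • ν z - τ) ∈ Ω := fun z hz x hx τ hτ s hs => by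
    rcases hs.1.eq_or_lt with h0 | h0
    · simpa [← h0] using hx.1
    · refine hcone z hz x hx (s * t) (by positivity) (by nlinarith [hs.2]) _ ?_
      rw [mul_smul, ← smul_sub, sub_sub_cancel_left, norm_smul, norm_neg,
        Real.norm_of_nonneg hs.1]
      nlinarith
  -- The translation error, cut off to its patch. The patches may overlap: at each point one of them
  -- suffices, and the norms of the others only enlarge the sum.
  set f : E n → E n → ℝ := fun z => (A z).indicator fun x => V (x + t • ν z) - v x with hf
  have hVc : Continuous V := continuous_mollify φ hv
  have hfm : ∀ z, Measurable (f z) := fun z => by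
    refine Measurable.indicator ?_ (hAm z)
    exact ((hVc.measurable).comp (measurable_id.add_const _)).sub hvm
  have hfn : ∀ z ∈ S, eLpNorm (f z) (ENNReal.ofReal p) (volume.restrict Ω) ≤
      ENNReal.ofReal (2 * t) * g := fun z hz => by
    rw [← ENNReal.rpow_le_rpow_iff hp0, eLpNorm_ofReal_rpow _ hp,
      ENNReal.mul_rpow_of_nonneg _ _ hp0.le, hg, eLpNorm_ofReal_rpow _ hp]
    refine le_trans ?_ (hw.lintegral_enorm_mollify_translate_sub_le hopen hv hvm hG hGm hp (hAm z)
      (u := t • ν z) (φ := φ) (R := 2 * t) ?_ ?_)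
    · refine (setLIntegral_le_lintegral _ _).trans_eq ?_
      rw [← lintegral_indicator (hAm z)]
      congr 1; ext x
      simp only [hf]
      by_cases hx : x ∈ A z
      · simp [hx, hV]
      · simp [hx, ENNReal.zero_rpow_of_pos hp0]
    · rw [norm_smul, Real.norm_of_nonneg ht0.le]
      nlinarith [hν z]
    · exact fun x hx τ hτ s hs => hconv z hz x hx τ (hτ.le.trans hφc) s hs
  set M : ℝ := L * (D + ε) / 2 with hM
  have hM0 : 0 ≤ M := by positivity
  have hpw : ∀ x ∈ Ω, ‖v x - a‖ ≤ M + ∑ z ∈ S, ‖f z x‖ := fun x hx => by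
    obtain ⟨z, hz, hxz⟩ := hcov x hx
    have hxA : x ∈ A z := ⟨hx, hxz⟩
    have h1 : ‖f z x‖ ≤ ∑ z ∈ S, ‖f z x‖ :=
      Finset.single_le_sum (f := fun z => ‖f z x‖) (fun _ _ => norm_nonneg _) hz
    -- The end of the cone, `s = 1`, is a ball of radius `c * t` about the translated point.
    have h2 : x + t • ν z ∈ K := fun y hy => by
      rw [Metric.mem_ball, dist_comm, dist_eq_norm] at hy
      have := hconv z hz x hxA (x + t • ν z - y) hy.le 1 (by simp)
      convert this using 1
      rw [one_smul]; abel
    have h3 := ha _ h2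
    have h4 : f z x = V (x + t • ν z) - v x := indicator_of_mem hxA _
    calc ‖v x - a‖ = ‖(V (x + t • ν z) - a) - f z x‖ := by rw [h4]; congr 1; ring
      _ ≤ ‖V (x + t • ν z) - a‖ + ‖f z x‖ := norm_sub_le _ _
      _ ≤ M + ∑ z ∈ S, ‖f z x‖ := add_le_add h3 h1
  have hP1 : 1 ≤ ENNReal.ofReal p := by simpa using ENNReal.ofReal_le_ofReal hp
  have step1 : eLpNorm (fun x => v x - a) (ENNReal.ofReal p) (volume.restrict Ω) ≤
      eLpNorm (fun x => M + ∑ z ∈ S, ‖f z x‖) (ENNReal.ofReal p) (volume.restrict Ω) := by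
    refine eLpNorm_mono_ae_real ?_
    filter_upwards [ae_restrict_mem hopen.measurableSet] with x hx using hpw x hx
  have step2 : eLpNorm (fun x => M + ∑ z ∈ S, ‖f z x‖) (ENNReal.ofReal p) (volume.restrict Ω) ≤
      eLpNorm (fun _ : E n => M) (ENNReal.ofReal p) (volume.restrict Ω) +
        ∑ z ∈ S, eLpNorm (fun x => ‖f z x‖) (ENNReal.ofReal p) (volume.restrict Ω) := by
    have hsum : (fun x => ∑ z ∈ S, ‖f z x‖) = ∑ z ∈ S, fun x => ‖f z x‖ := by
      ext x; simp
    refine (eLpNorm_add_le aestronglyMeasurable_const ?_ hP1).trans ?_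
    · exact (Finset.measurable_fun_sum S fun z _ => (hfm z).norm).aestronglyMeasurable
    · gcongr
      rw [hsum]
      exact eLpNorm_sum_le (fun z _ => (hfm z).norm.aestronglyMeasurable) hP1
  have step3 : ∑ z ∈ S, eLpNorm (fun x => ‖f z x‖) (ENNReal.ofReal p) (volume.restrict Ω) ≤
      ENNReal.ofReal ε * g := by
    calc _ ≤ ∑ z ∈ S, ENNReal.ofReal (2 * t) * g :=
          Finset.sum_le_sum fun z hz => by rw [eLpNorm_norm]; exact hfn z hz
      _ = ENNReal.ofReal (S.card * (2 * t)) * g := by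
          rw [Finset.sum_const, nsmul_eq_mul, ← mul_assoc, ENNReal.ofReal_mul (by positivity)]
          simp
      _ ≤ _ := by gcongr
  have step4 : eLpNorm (fun _ : E n => M) (ENNReal.ofReal p) (volume.restrict Ω) ≤
      ENNReal.ofReal ((D + ε) / 2 * (B * ((volume Ω).toReal + 1)) ^ (1 / p)) * g := by
    have hM' : ‖M‖ₑ = ENNReal.ofReal ((D + ε) / 2) * (ENNReal.ofReal B ^ (1 / p) * g) := by
      rw [Real.enorm_of_nonneg hM0, ← ENNReal.coe_toNNReal hLtop, ← hL,
        ← ENNReal.ofReal_coe_nnreal, ← ENNReal.ofReal_mul (by positivity), hM]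
      congr 1; ring
    rw [eLpNorm_const' _ (by simpa using hp0) (by simp), ENNReal.toReal_ofReal hp0.le, hM',
      Measure.restrict_apply_univ, ENNReal.ofReal_mul (by positivity),
      ← ENNReal.ofReal_rpow_of_nonneg (by positivity) (by positivity),
      ENNReal.ofReal_mul hB0.le, ENNReal.mul_rpow_of_nonneg _ _ (by positivity)]
    have hvle : volume Ω ≤ ENNReal.ofReal ((volume Ω).toReal + 1) := by
      rw [← ENNReal.ofReal_toReal hvol]
      apply ENNReal.ofReal_le_ofReal
      rw [ENNReal.ofReal_toReal hvol]; linarith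
    calc _ = ENNReal.ofReal ((D + ε) / 2) * (ENNReal.ofReal B ^ (1 / p) *
          volume Ω ^ (1 / p)) * g := by ring
      _ ≤ _ := by gcongr
  refine (step1.trans step2).trans ?_
  rw [ENNReal.ofReal_add (by positivity) hε.le, add_mul]
  exact add_le_add step4 step3

end Core

/-! ### Normalization and the lower bound. -/

/-- The tangent line inequality for `|x| ^ p`. -/
theorem abs_rpow_sub_mul_le {p : ℝ} (hp : 1 ≤ p) (x a : ℝ) :
    |x| ^ p - p * a * (|x| ^ (p - 2) * x) ≤ |x - a| ^ p := by
  rcases eq_or_ne x 0 with rfl | hx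
  · simp only [abs_zero, mul_zero, sub_zero]
    rw [Real.zero_rpow (by linarith)]
    positivity
  · have hx0 : 0 < |x| := abs_pos.2 hx
    -- Division by `|x| ^ p` reduces the claim to Bernoulli's inequality for `-(a / x)`; if `a / x >
    -- 1` the left side is negative.
    have key : 1 - p * (a / x) ≤ |1 - a / x| ^ p := by
      rcases le_or_gt (a / x) 1 with h | h
      · rw [abs_of_nonneg (by linarith)]
        have := one_add_mul_self_le_rpow_one_add (s := -(a / x)) (by linarith) hp
        rw [← sub_eq_add_neg] at this
        linarith
      · have : 0 ≤ |1 - a / x| ^ p := by positivity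
        nlinarith
    have h1 : |x - a| ^ p = |x| ^ p * |1 - a / x| ^ p := by
      rw [← Real.mul_rpow (abs_nonneg _) (abs_nonneg _), ← abs_mul, mul_sub, mul_one,
        mul_div_cancel₀ _ hx]
    have h2 : |x| ^ p * (a / x) = a * (|x| ^ (p - 2) * x) := by
      have : |x| ^ p = |x| ^ (p - 2) * (x * x) := by
        rw [← abs_mul_abs_self x, ← sq, ← Real.rpow_natCast, ← Real.rpow_add hx0]
        norm_num
      rw [this]; field_simp
    calc |x| ^ p - p * a * (|x| ^ (p - 2) * x) = |x| ^ p * (1 - p * (a / x)) := by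
          rw [mul_assoc, ← h2]; ring
      _ ≤ _ := by rw [h1]; gcongr

theorem abs_rpow_sub_two_mul_abs {p : ℝ} (hp : 1 < p) (x : ℝ) :
    |(|x| ^ (p - 2) * x)| = |x| ^ (p - 1) := by
  rcases eq_or_ne x 0 with rfl | hx
  · simp [Real.zero_rpow (show p - 1 ≠ 0 by linarith)]
  · rw [abs_mul, abs_of_nonneg (by positivity : 0 ≤ |x| ^ (p - 2))]
    conv_lhs => rw [← Real.rpow_one |x|, ← Real.rpow_mul (abs_nonneg x), one_mul]
    rw [← Real.rpow_add (abs_pos.2 hx)]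
    congr 1; ring

theorem measurable_abs_rpow_sub_two_mul (p : ℝ) :
    Measurable fun x : ℝ => |x| ^ (p - 2) * x := by
  fun_prop

section

variable {α : Type*} [MeasurableSpace α] {μ : Measure α}

theorem integrable_norm_rpow_of_memLp {F : Type*} [NormedAddCommGroup F] {f : α → F} {p : ℝ}
    (hp : 1 ≤ p) (hf : MemLp f (ENNReal.ofReal p) μ) : Integrable (fun x => ‖f x‖ ^ p) μ := by
  have := hf.integrable_norm_rpow (by simp; linarith) (by simp)
  rwa [ENNReal.toReal_ofReal (by linarith)] at this

/-- A function with `∫ |v|^{p-2} v = 0` is closer to `0` in `L^p` than to any other constant. -/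
theorem integral_abs_rpow_le_of_orthogonal [IsFiniteMeasure μ] {v : α → ℝ} {p : ℝ} (hp : 1 < p)
    (hv : MemLp v (ENNReal.ofReal p) μ) (h0 : ∫ x, |v x| ^ (p - 2) * v x ∂μ = 0) (a : ℝ) :
    ∫ x, |v x| ^ p ∂μ ≤ ∫ x, |v x - a| ^ p ∂μ := by
  have i1 : Integrable (fun x => |v x| ^ p) μ := integrable_norm_rpow_of_memLp hp.le hv
  have i2 : Integrable (fun x => |v x - a| ^ p) μ :=
    integrable_norm_rpow_of_memLp hp.le (hv.sub (memLp_const a))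
  have i3 : Integrable (fun x => |v x| ^ (p - 2) * v x) μ := by
    refine (i1.add (integrable_const 1)).mono'
      ((measurable_abs_rpow_sub_two_mul p).comp_aemeasurable
        hv.aestronglyMeasurable.aemeasurable).aestronglyMeasurable
      (Eventually.of_forall fun x => ?_)
    rw [Real.norm_eq_abs, abs_rpow_sub_two_mul_abs hp, Pi.add_apply]
    rcases le_or_gt |v x| 1 with h | h
    · have h1 : |v x| ^ (p - 1) ≤ 1 := Real.rpow_le_one (abs_nonneg _) h (by linarith)
      have h2 : 0 ≤ |v x| ^ p := by positivity
      linarith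
    · have h1 : |v x| ^ (p - 1) ≤ |v x| ^ p := Real.rpow_le_rpow_of_exponent_le h.le (by linarith)
      linarith
  -- The linear term of the tangent line integrates to zero by the normalization.
  calc ∫ x, |v x| ^ p ∂μ = ∫ x, (|v x| ^ p - p * a * (|v x| ^ (p - 2) * v x)) ∂μ := by
        rw [integral_sub i1 (i3.const_mul _), integral_const_mul, h0]; ring
    _ ≤ ∫ x, |v x - a| ^ p ∂μ :=
        integral_mono (i1.sub (i3.const_mul _)) i2 fun x => abs_rpow_sub_mul_le hp.le (v x) a

theorem ofReal_integral_norm_rpow {F : Type*} [NormedAddCommGroup F] {f : α → F} {p : ℝ}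
    (hp : 1 ≤ p) (hf : MemLp f (ENNReal.ofReal p) μ) :
    ENNReal.ofReal (∫ x, ‖f x‖ ^ p ∂μ) = eLpNorm f (ENNReal.ofReal p) μ ^ p := by
  rw [eLpNorm_ofReal_rpow _ hp, ofReal_integral_eq_lintegral_ofReal
    (integrable_norm_rpow_of_memLp hp hf) (Eventually.of_forall fun x => by positivity)]
  congr 1; ext x
  rw [← ENNReal.ofReal_rpow_of_nonneg (norm_nonneg _) (by linarith), ofReal_norm]

end

variable {n : ℕ} {Ω : Set (E n)}

/-- The extension by zero of a measurable version of a Sobolev function. -/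
theorem MemW1p.exists_extension (hopen : IsOpen Ω) (hvol : volume Ω ≠ ⊤) {p : ℝ} (hp : 1 ≤ p)
    {v : E n → ℝ} {G : E n → E n} (h : MemW1p Ω p v G) :
    ∃ (v' : E n → ℝ) (G' : E n → E n), Measurable v' ∧ Measurable G' ∧ LocallyIntegrable v' ∧
      LocallyIntegrable G' ∧ IsWeakGradient Ω v' G' ∧ v' =ᵐ[volume.restrict Ω] v ∧
      eLpNorm G' (ENNReal.ofReal p) = eLpNorm G (ENNReal.ofReal p) (volume.restrict Ω) := by
  obtain ⟨hv, hG, -, -, hw⟩ := h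
  have hm := hopen.measurableSet
  have : IsFiniteMeasure (volume.restrict Ω) := ⟨by simpa using hvol.lt_top⟩
  have hP1 : 1 ≤ ENNReal.ofReal p := by simpa using ENNReal.ofReal_le_ofReal hp
  have hvae := hv.1.ae_eq_mk
  have hGae := hG.1.ae_eq_mk
  have iv : IntegrableOn (hv.1.mk v) Ω := (hv.integrable hP1).congr hvae
  have iG : IntegrableOn (hG.1.mk G) Ω := (hG.integrable hP1).congr hGae
  refine ⟨Ω.indicator (hv.1.mk v), Ω.indicator (hG.1.mk G),
    hv.1.stronglyMeasurable_mk.measurable.indicator hm,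
    hG.1.stronglyMeasurable_mk.measurable.indicator hm,
    (iv.integrable_indicator hm).locallyIntegrable,
    (iG.integrable_indicator hm).locallyIntegrable, fun ψ h1 h2 h3 e => ?_, ?_, ?_⟩
  · have key := hw ψ h1 h2 h3 e
    have e1 : ∫ x, Ω.indicator (hv.1.mk v) x * fderiv ℝ ψ x e =
        ∫ x in Ω, v x * fderiv ℝ ψ x e := by
      rw [← integral_indicator hm]
      have : (fun x => Ω.indicator (hv.1.mk v) x * fderiv ℝ ψ x e) =
          Ω.indicator fun x => hv.1.mk v x * fderiv ℝ ψ x e := by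
        ext x; by_cases hx : x ∈ Ω <;> simp [hx]
      rw [this, integral_indicator hm, integral_indicator hm]
      refine integral_congr_ae ?_
      filter_upwards [hvae] with x hx
      rw [hx]
    have e2 : ∫ x, ⟪Ω.indicator (hG.1.mk G) x, e⟫ * ψ x = ∫ x in Ω, ⟪G x, e⟫ * ψ x := by
      have : (fun x => ⟪Ω.indicator (hG.1.mk G) x, e⟫ * ψ x) =
          Ω.indicator fun x => ⟪hG.1.mk G x, e⟫ * ψ x := by
        ext x; by_cases hx : x ∈ Ω <;> simp [hx]
      rw [this, integral_indicator hm]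
      refine integral_congr_ae ?_
      filter_upwards [hGae] with x hx
      rw [hx]
    rw [e1, e2, key]
  · filter_upwards [ae_restrict_mem hm, hvae] with x hx h
    rw [indicator_of_mem hx, h]
  · rw [eLpNorm_indicator_eq_eLpNorm_restrict hm]
    exact eLpNorm_congr_ae hGae.symm

theorem rayleighValues_nonneg {p r : ℝ} (hr : r ∈ rayleighValues Ω p) : 0 ≤ r := by
  obtain ⟨v, G, -, -, -, rfl⟩ := hr
  positivity

/-- A uniform lower bound of the Rayleigh quotients. -/
theorem exists_le_rayleighValues (hopen : IsOpen Ω) (hbdd : Bornology.IsBounded Ω)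
    (hLip : HasLipschitzBoundary Ω) {D : NNReal} (hD : intrinsicDiam Ω = D) {ε : ℝ}
    (hε : 0 < ε) :
    ∃ Q : ℝ, 0 < Q ∧ ∀ p : ℝ, 1 < p → ∀ r ∈ rayleighValues Ω p,
      (1 / ((D + ε) / 2 * Q ^ (1 / p) + ε)) ^ p ≤ r := by
  obtain ⟨Q, hQ, hmain⟩ := exists_poincare hopen hbdd hLip hD hε
  refine ⟨Q, hQ, fun p hp r hr => ?_⟩
  obtain ⟨v, G, hvG, hne, h0, rfl⟩ := hr
  have hp0 : 0 < p := by linarith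
  have hvol : volume Ω ≠ ⊤ := hbdd.measure_lt_top.ne
  have : IsFiniteMeasure (volume.restrict Ω) := ⟨by simpa using hvol.lt_top⟩
  obtain ⟨v', G', hvm, hGm, hv, hG, hw, hvv, hGG⟩ := hvG.exists_extension hopen hvol hp.le
  obtain ⟨a, ha⟩ := hmain p v' G' hp.le hvm hGm hv hG hw (by rw [hGG]; exact hvG.2.1.2.ne)
  set C : ℝ := (D + ε) / 2 * Q ^ (1 / p) + ε with hC
  have hC0 : 0 < C := by positivity
  have hle : ∫ x in Ω, |v x| ^ p ≤ C ^ p * ∫ x in Ω, ‖G x‖ ^ p := by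
    refine (integral_abs_rpow_le_of_orthogonal hp hvG.1 h0 a).trans ?_
    rw [hGG, ← ENNReal.rpow_le_rpow_iff hp0, ENNReal.mul_rpow_of_nonneg _ _ hp0.le,
      ← ofReal_integral_norm_rpow hp.le hvG.2.1, ENNReal.ofReal_rpow_of_pos hC0,
      ← ENNReal.ofReal_mul (by positivity)] at ha
    have e1 : eLpNorm (fun x => v' x - a) (ENNReal.ofReal p) (volume.restrict Ω) =
        eLpNorm (fun x => v x - a) (ENNReal.ofReal p) (volume.restrict Ω) :=
      eLpNorm_congr_ae (by filter_upwards [hvv] with x hx; rw [hx])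
    have hva : MemLp (fun x => v x - a) (ENNReal.ofReal p) (volume.restrict Ω) :=
      hvG.1.sub (memLp_const a)
    rw [e1, ← ofReal_integral_norm_rpow hp.le hva] at ha
    exact (ENNReal.ofReal_le_ofReal_iff (by positivity)).1 ha
  have hpos : 0 < ∫ x in Ω, |v x| ^ p := by
    have hi : Integrable (fun x => |v x| ^ p) (volume.restrict Ω) :=
      integrable_norm_rpow_of_memLp hp.le hvG.1
    refine lt_of_le_of_ne (by positivity) fun h => hne ?_
    have := (integral_eq_zero_iff_of_nonneg (fun x => by positivity) hi).1 h.symm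
    filter_upwards [this] with x hx
    have : |v x| = 0 := by
      have hx' : |v x| ^ p = 0 := hx
      rwa [Real.rpow_eq_zero (abs_nonneg _) hp0.ne'] at hx'
    simpa using this
  rw [le_div_iff₀ hpos, Real.div_rpow zero_le_one hC0.le, Real.one_rpow, div_mul_eq_mul_div,
    one_mul, div_le_iff₀ (by positivity), mul_comm]
  exact hle

/-! ### The upper bound by intrinsic distance functions. -/

/-- A locally Lipschitz function has its pointwise a.e. gradient as weak gradient. -/
theorem integral_mul_fderiv_eq_of_locallyLipschitzOn (hopen : IsOpen Ω) {v : E n → ℝ}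
    (hv : LocallyLipschitzOn Ω v) {ψ : E n → ℝ} (hψ : ContDiff ℝ ∞ ψ) (hψc : HasCompactSupport ψ)
    (hψΩ : tsupport ψ ⊆ Ω) (e : E n) :
    ∫ x in Ω, v x * fderiv ℝ ψ x e = -∫ x in Ω, ⟪gradient v x, e⟫ * ψ x := by
  -- On a compact neighbourhood of the support of `ψ` the function is Lipschitz, and extends to a
  -- globally Lipschitz `g`. Integration by parts for `g` suffices, as `v` and `g` agree near each
  -- point of the support.
  obtain ⟨δ, hδ, hsub⟩ := hψc.isCompact.exists_cthickening_subset_open hopen hψΩ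
  obtain ⟨C, hC⟩ := (hv.mono hsub).exists_lipschitzOnWith_of_compact
    (hψc.isCompact.cthickening (r := δ))
  obtain ⟨g, hg, hgv⟩ := hC.extend_real
  obtain ⟨C', hψL⟩ := ContDiff.lipschitzWith_of_hasCompactSupport hψc hψ (by simp)
  have hibp := LipschitzWith.integral_lineDeriv_mul_eq (μ := volume) hg hψL hψc e
  have hψd : ∀ x, DifferentiableAt ℝ ψ x := hψ.differentiable (by simp)
  have hnear : ∀ x ∈ tsupport ψ, v =ᶠ[𝓝 x] g := fun x hx => by
    filter_upwards [Metric.isOpen_thickening.mem_nhds (Metric.self_subset_thickening hδ _ hx)]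
      with y hy using hgv (Metric.thickening_subset_cthickening _ _ hy)
  have hzero : ∀ x ∉ tsupport ψ, ψ x = 0 := fun x hx => image_eq_zero_of_notMem_tsupport hx
  have hzero' : ∀ x ∉ tsupport ψ, fderiv ℝ ψ x = 0 := fun x hx =>
    image_eq_zero_of_notMem_tsupport fun h => hx (tsupport_fderiv_subset ℝ h)
  have e1 : ∫ x in Ω, v x * fderiv ℝ ψ x e = ∫ x, g x * fderiv ℝ ψ x e := by
    rw [setIntegral_eq_integral_of_forall_compl_eq_zero fun x hx => by
      rw [hzero' x fun h => hx (hψΩ h)]; simp]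
    congr 1; ext x
    by_cases hx : x ∈ tsupport ψ
    · rw [(hnear x hx).eq_of_nhds]
    · rw [hzero' x hx]; simp
  have e2 : ∫ x in Ω, ⟪gradient v x, e⟫ * ψ x = ∫ x, lineDeriv ℝ g x e * ψ x := by
    rw [setIntegral_eq_integral_of_forall_compl_eq_zero fun x hx => by
      rw [hzero x fun h => hx (hψΩ h), mul_zero]]
    refine integral_congr_ae ?_
    filter_upwards [hg.ae_differentiableAt] with x hgx
    by_cases hx : x ∈ tsupport ψ
    · rw [hgx.lineDeriv_eq_fderiv, gradient, InnerProductSpace.toDual_symm_apply,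
        (hnear x hx).fderiv_eq]
    · rw [hzero x hx, mul_zero, mul_zero]
  rw [e1, e2, hibp, ← integral_neg]
  congr 1; ext x
  rw [(hψd x).lineDeriv_eq_fderiv, map_neg]; ring

/-- The normalization `∫ |u - c|^{p-2} (u - c) = 0` can be achieved by subtracting a constant. -/
theorem exists_integral_abs_rpow_mul_eq_zero {α : Type*} [MeasurableSpace α] {μ : Measure α}
    [IsFiniteMeasure μ] {u : α → ℝ} (hu : AEStronglyMeasurable u μ) {D : ℝ} (hD : 0 ≤ D)
    (h0 : ∀ᵐ x ∂μ, 0 ≤ u x) (h1 : ∀ᵐ x ∂μ, u x ≤ D) {p : ℝ} (hp : 2 ≤ p) :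
    ∃ c : ℝ, ∫ x, |u x - c| ^ (p - 2) * (u x - c) ∂μ = 0 := by
  have hcont : Continuous fun t : ℝ => |t| ^ (p - 2) * t :=
    (continuous_abs.rpow_const fun _ => Or.inr (by linarith)).mul continuous_id
  have hc : ContinuousOn (fun c => ∫ x, |u x - c| ^ (p - 2) * (u x - c) ∂μ) (Icc 0 D) := by
    refine continuousOn_of_dominated (bound := fun _ => D ^ (p - 1)) (fun c _ => ?_)
      (fun c hc => ?_) (integrable_const _) (Eventually.of_forall fun x => ?_)
    · exact hcont.comp_aestronglyMeasurable (hu.sub aestronglyMeasurable_const)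
    · filter_upwards [h0, h1] with x hx0 hx1
      rw [Real.norm_eq_abs, abs_rpow_sub_two_mul_abs (by linarith)]
      refine Real.rpow_le_rpow (abs_nonneg _) ?_ (by linarith)
      rw [abs_le]; constructor <;> linarith [hc.1, hc.2]
    · exact (hcont.comp (continuous_const.sub continuous_id)).continuousOn
  -- As `0 ≤ u ≤ D`, the integral has opposite signs at `c = 0` and `c = D`; the intermediate value
  -- theorem gives the zero.
  have h2 : 0 ≤ ∫ x, |u x - 0| ^ (p - 2) * (u x - 0) ∂μ := by
    refine integral_nonneg_of_ae ?_
    filter_upwards [h0] with x hx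
    simp only [sub_zero, Pi.zero_apply]; positivity
  have h3 : ∫ x, |u x - D| ^ (p - 2) * (u x - D) ∂μ ≤ 0 := by
    refine integral_nonpos_of_ae ?_
    filter_upwards [h1] with x hx
    exact mul_nonpos_of_nonneg_of_nonpos (by positivity) (by simpa using hx)
  obtain ⟨c, -, hc0⟩ := intermediate_value_Icc' hD hc ⟨h3, h2⟩
  exact ⟨c, hc0⟩

theorem intrinsicDist_le_of_diam {D : NNReal} (hD : intrinsicDiam Ω = D) {x y : E n} (hx : x ∈ Ω)
    (hy : y ∈ Ω) : intrinsicDist Ω x y ≤ D := by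
  rw [← hD]
  exact le_iSup₂_of_le x hx (le_iSup₂_of_le y hy le_rfl)

/-- In a ball contained in `Ω` segments are admissible curves, so the triangle inequality gives the
Euclidean Lipschitz constant `1`. -/
theorem lipschitzOnWith_intrinsicDist_toReal {D : NNReal} (hD : intrinsicDiam Ω = D) {x₀ c : E n}
    {r : ℝ} (hx₀ : x₀ ∈ Ω) (hb : Metric.ball c r ⊆ Ω) :
    LipschitzOnWith 1 (fun z => (intrinsicDist Ω x₀ z).toReal) (Metric.ball c r) := by
  refine LipschitzOnWith.of_le_add fun x hx y hy => ?_
  have hfin : ∀ z ∈ Metric.ball c r, intrinsicDist Ω x₀ z ≠ ⊤ := fun z hz =>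
    ((intrinsicDist_le_of_diam hD hx₀ (hb hz)).trans_lt ENNReal.coe_lt_top).ne
  have h : intrinsicDist Ω x₀ x ≤ intrinsicDist Ω x₀ y + edist x y := by
    refine (intrinsicDist_triangle Ω x₀ y x).trans ?_
    gcongr
    rw [edist_comm]
    exact intrinsicDist_le_edist_of_ball hb hy hx
  have h2 := ENNReal.toReal_mono (ENNReal.add_ne_top.2 ⟨hfin y hy, edist_ne_top x y⟩) h
  rwa [ENNReal.toReal_add (hfin y hy) (edist_ne_top x y), ← dist_edist] at h2

/-- Shifted intrinsic distance functions give an upper bound of the infimum of the Rayleigh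
quotients. -/
theorem exists_rayleighValues_le (hopen : IsOpen Ω) (hbdd : Bornology.IsBounded Ω) {D : NNReal}
    (hD : intrinsicDiam Ω = D) {s : ℝ} (hs0 : 0 < s) (hs : s < D / 2) :
    ∃ Q : ℝ, 0 < Q ∧ ∀ p : ℝ, 2 ≤ p → ∃ r ∈ rayleighValues Ω p, r ≤ Q / s ^ p := by
  obtain ⟨D', hD'1, hD'2⟩ : ∃ D' : ℝ, 2 * s < D' ∧ D' < D := exists_between (by linarith)
  obtain ⟨x₀, hx₀, y₀, hy₀, hlt⟩ : ∃ x ∈ Ω, ∃ y ∈ Ω, ENNReal.ofReal D' < intrinsicDist Ω x y := by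
    have : ENNReal.ofReal D' < intrinsicDiam Ω := by
      rw [hD, ← ENNReal.ofReal_coe_nnreal]
      exact (ENNReal.ofReal_lt_ofReal_iff (by linarith)).2 hD'2
    unfold intrinsicDiam at this
    simp only [lt_iSup_iff] at this
    obtain ⟨x, hx, y, hy, h⟩ := this
    exact ⟨x, hx, y, hy, h⟩
  set u : E n → ℝ := fun z => (intrinsicDist Ω x₀ z).toReal with hu
  have hD'u : D' ≤ u y₀ := by
    have hfin : intrinsicDist Ω x₀ y₀ ≠ ⊤ :=
      ((intrinsicDist_le_of_diam hD hx₀ hy₀).trans_lt ENNReal.coe_lt_top).ne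
    exact (ENNReal.ofReal_le_iff_le_toReal hfin).1 hlt.le
  have huD : ∀ x ∈ Ω, u x ≤ D := fun x hx => by
    have := ENNReal.toReal_mono ENNReal.coe_ne_top (intrinsicDist_le_of_diam hD hx₀ hx)
    simpa using this
  have hux₀ : u x₀ = 0 := by
    have : intrinsicDist Ω x₀ x₀ ≤ edist x₀ x₀ := intrinsicDist_le_edist_of_segment_subset (by
      rw [segment_same]; simpa using hx₀)
    rw [edist_self, nonpos_iff_eq_zero] at this
    simp [hu, this]
  have hloc : ∀ x ∈ Ω, ∃ t ∈ 𝓝 x, LipschitzOnWith 1 u t := fun x hx => by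
    obtain ⟨r, hr, hb⟩ := Metric.isOpen_iff.1 hopen x hx
    exact ⟨_, Metric.ball_mem_nhds x hr, lipschitzOnWith_intrinsicDist_toReal hD hx₀ hb⟩
  have hcont : ContinuousOn u Ω := fun x hx => by
    obtain ⟨t, ht, hL⟩ := hloc x hx
    exact (hL.continuousOn.continuousAt ht).continuousWithinAt
  -- With radius at most `D' / 2 - s`, the 1-Lipschitz `u` stays below `D' / 2 - s` near `x₀` and
  -- above `D' / 2 + s` near `y₀`.
  obtain ⟨ρ, hρ0, hρη, hρx, hρy⟩ : ∃ ρ > 0, ρ ≤ D' / 2 - s ∧ Metric.ball x₀ ρ ⊆ Ω ∧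
      Metric.ball y₀ ρ ⊆ Ω := by
    obtain ⟨r, hr, hb⟩ := Metric.isOpen_iff.1 hopen x₀ hx₀
    obtain ⟨r', hr', hb'⟩ := Metric.isOpen_iff.1 hopen y₀ hy₀
    have : 0 < D' / 2 - s := by linarith
    exact ⟨min (D' / 2 - s) (min r r'), by positivity, min_le_left _ _,
      (Metric.ball_subset_ball ((min_le_right _ _).trans (min_le_left _ _))).trans hb,
      (Metric.ball_subset_ball ((min_le_right _ _).trans (min_le_right _ _))).trans hb'⟩
  have hux : ∀ z ∈ Metric.ball x₀ ρ, u z ≤ D' / 2 - s := fun z hz => by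
    have := (lipschitzOnWith_intrinsicDist_toReal hD hx₀ hρx).dist_le_mul z hz x₀
      (Metric.mem_ball_self hρ0)
    have h2 : |u z - u x₀| ≤ 1 * dist z x₀ := this
    rw [hux₀] at h2
    linarith [(abs_le.1 h2).2, Metric.mem_ball.1 hz]
  have huy : ∀ z ∈ Metric.ball y₀ ρ, D' / 2 + s ≤ u z := fun z hz => by
    have := (lipschitzOnWith_intrinsicDist_toReal hD hx₀ hρy).dist_le_mul z hz y₀
      (Metric.mem_ball_self hρ0)
    have h2 : |u z - u y₀| ≤ 1 * dist z y₀ := this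
    linarith [(abs_le.1 h2).1, Metric.mem_ball.1 hz]
  set m : ℝ := (volume (Metric.ball x₀ ρ)).toReal with hm
  have hm0 : 0 < m :=
    ENNReal.toReal_pos (Metric.measure_ball_pos volume x₀ hρ0).ne' measure_ball_lt_top.ne
  have hmy : (volume (Metric.ball y₀ ρ)).toReal = m := by
    rw [hm, Measure.addHaar_ball_center, Measure.addHaar_ball_center volume x₀]
  have hvol : volume Ω ≠ ⊤ := hbdd.measure_lt_top.ne
  have : IsFiniteMeasure (volume.restrict Ω) := ⟨by simpa using hvol.lt_top⟩
  have hmeas := hopen.measurableSet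
  refine ⟨((volume Ω).toReal + 1) / m, by positivity, fun p hp => ?_⟩
  have hp0 : 0 < p := by linarith
  have hum : AEStronglyMeasurable u (volume.restrict Ω) := hcont.aestronglyMeasurable hmeas
  have hae : ∀ᵐ x ∂(volume.restrict Ω), x ∈ Ω := ae_restrict_mem hmeas
  obtain ⟨c, hc⟩ := exists_integral_abs_rpow_mul_eq_zero hum D.coe_nonneg
    (Eventually.of_forall fun x => ENNReal.toReal_nonneg) (hae.mono huD) hp
  set v : E n → ℝ := fun x => u x - c with hv
  have hvloc : ∀ x ∈ Ω, ∃ t ∈ 𝓝 x, LipschitzOnWith 1 v t := fun x hx => by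
    obtain ⟨t, ht, hL⟩ := hloc x hx
    refine ⟨t, ht, LipschitzOnWith.of_dist_le_mul fun y hy z hz => ?_⟩
    have := hL.dist_le_mul y hy z hz
    simpa [hv, Real.dist_eq] using this
  have hvlip : LocallyLipschitzOn Ω v := fun x hx => by
    obtain ⟨t, ht, hL⟩ := hvloc x hx
    exact ⟨1, t, mem_nhdsWithin_of_mem_nhds ht, hL⟩
  have hG1 : ∀ x ∈ Ω, ‖gradient v x‖ ≤ 1 := fun x hx => by
    obtain ⟨t, ht, hL⟩ := hvloc x hx
    rw [gradient, LinearIsometryEquiv.norm_map]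
    simpa using norm_fderiv_le_of_lipschitzOn ℝ ht hL
  have hGm : Measurable (gradient v) :=
    (InnerProductSpace.toDual ℝ (E n)).symm.continuous.measurable.comp (measurable_fderiv ℝ v)
  have hvm : AEStronglyMeasurable v (volume.restrict Ω) := hum.sub aestronglyMeasurable_const
  have hvb : ∀ᵐ x ∂(volume.restrict Ω), ‖v x‖ ≤ D + |c| := hae.mono fun x hx => by
    rw [Real.norm_eq_abs]
    have h1 : 0 ≤ u x := ENNReal.toReal_nonneg
    calc |v x| ≤ |u x| + |c| := abs_sub _ _
      _ ≤ D + |c| := by rw [abs_of_nonneg h1]; gcongr; exact huD x hx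
  have hvL : ∀ q, MemLp v q (volume.restrict Ω) := fun q => MemLp.of_bound hvm _ hvb
  have hGL : ∀ q, MemLp (gradient v) q (volume.restrict Ω) := fun q =>
    MemLp.of_bound hGm.aestronglyMeasurable 1 (hae.mono hG1)
  have hW : MemW1p Ω p v (gradient v) := by
    refine ⟨hvL _, hGL _, ?_, ?_, fun ψ h1 h2 h3 e =>
      integral_mul_fderiv_eq_of_locallyLipschitzOn hopen hvlip h1 h2 h3 e⟩
    · have : IntegrableOn v Ω := (memLp_one_iff_integrable.1 (hvL 1))
      exact this.locallyIntegrableOn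
    · have : IntegrableOn (gradient v) Ω := (memLp_one_iff_integrable.1 (hGL 1))
      exact this.locallyIntegrableOn
  have hnum : ∫ x in Ω, ‖gradient v x‖ ^ p ≤ (volume Ω).toReal + 1 := by
    calc ∫ x in Ω, ‖gradient v x‖ ^ p ≤ ∫ _ in Ω, (1:ℝ) := by
          refine integral_mono_ae (integrable_norm_rpow_of_memLp (by linarith) (hGL _))
            (integrable_const _) (hae.mono fun x hx => ?_)
          exact Real.rpow_le_one (norm_nonneg _) (hG1 x hx) hp0.le
      _ ≤ _ := by simp [Measure.real]
  have hi : IntegrableOn (fun x => |v x| ^ p) Ω :=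
    integrable_norm_rpow_of_memLp (by linarith) (hvL _)
  have hball : ∀ z, Metric.ball z ρ ⊆ Ω → (volume (Metric.ball z ρ)).toReal = m →
      (∀ x ∈ Metric.ball z ρ, s ≤ |v x|) → s ^ p * m ≤ ∫ x in Ω, |v x| ^ p :=
    fun z hz hzm hzs => by
      calc s ^ p * m = ∫ _ in Metric.ball z ρ, s ^ p := by
            rw [setIntegral_const, smul_eq_mul, Measure.real, hzm, mul_comm]
        _ ≤ ∫ x in Metric.ball z ρ, |v x| ^ p := by
            refine setIntegral_mono_on (integrableOn_const measure_ball_lt_top.ne)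
              (hi.mono_set hz) measurableSet_ball fun x hx => ?_
            exact Real.rpow_le_rpow hs0.le (hzs x hx) hp0.le
        _ ≤ ∫ x in Ω, |v x| ^ p :=
            setIntegral_mono_set hi (Eventually.of_forall fun x => by positivity)
              (LE.le.eventuallyLE hz)
  have hden : s ^ p * m ≤ ∫ x in Ω, |v x| ^ p := by
    -- Whichever side of `D' / 2` the shift `c` lies on, the values of `u` on the opposite ball
    -- differ from it by at least `s`.
    rcases le_total (D' / 2) c with hc | hc
    · refine hball x₀ hρx rfl fun x hx => ?_
      rw [abs_sub_comm]
      exact (by linarith [hux x hx] : s ≤ c - u x).trans (le_abs_self _)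
    · refine hball y₀ hρy hmy fun x hx => ?_
      exact (by linarith [huy x hx] : s ≤ u x - c).trans (le_abs_self _)
  have hsm : 0 < s ^ p * m := by positivity
  refine ⟨_, ⟨v, gradient v, hW, fun h0 => ?_, hc, rfl⟩, ?_⟩
  · have : ∫ x in Ω, |v x| ^ p = 0 := by
      rw [integral_congr_ae (g := fun _ => (0:ℝ))]
      · simp
      · filter_upwards [h0] with x hx
        rw [hx, Pi.zero_apply, abs_zero, Real.zero_rpow hp0.ne']
    linarith
  · rw [div_div, mul_comm m]
    exact div_le_div₀ (by positivity) hnum hsm hden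

/-! ### Passage to the limit. -/

theorem tendsto_rpow_one_div_atTop {Q : ℝ} (hQ : 0 < Q) :
    Tendsto (fun p : ℝ => Q ^ (1 / p)) atTop (𝓝 1) := by
  have h : Tendsto (fun p : ℝ => 1 / p) atTop (𝓝 0) := by
    simpa only [one_div] using tendsto_inv_atTop_zero
  simpa using (tendsto_const_nhds (x := Q)).rpow h (Or.inl hQ.ne')

theorem tendsto_neumannLambda (hopen : IsOpen Ω)
    (hbdd : Bornology.IsBounded Ω) (hLip : HasLipschitzBoundary Ω) {D : NNReal} (hD0 : 0 < D)
    (hD : intrinsicDiam Ω = D) :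
    Tendsto (fun p : ℝ => neumannLambda Ω p) atTop (𝓝 (2 / D)) := by
  have hD0' : (0:ℝ) < D := hD0
  rw [tendsto_order]
  constructor
  · intro a ha
    obtain ⟨ε, hε, haε⟩ : ∃ ε : ℝ, 0 < ε ∧ a < 1 / ((D + ε) / 2 + ε) := by
      have h : Tendsto (fun ε : ℝ => 1 / (((D:ℝ) + ε) / 2 + ε)) (𝓝[>] 0) (𝓝 (2 / D)) := by
        have hc : ContinuousAt (fun ε : ℝ => 1 / (((D:ℝ) + ε) / 2 + ε)) 0 :=
          ContinuousAt.div (by fun_prop) (by fun_prop) (by simpa using hD0'.ne')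
        have := hc.tendsto
        simp only [add_zero, one_div_div] at this
        exact this.mono_left nhdsWithin_le_nhds
      obtain ⟨ε, h1, h2⟩ := ((h.eventually_const_lt ha).and self_mem_nhdsWithin).exists
      exact ⟨ε, h2, h1⟩
    obtain ⟨Q, hQ, hle⟩ := exists_le_rayleighValues hopen hbdd hLip hD hε
    -- Any `s` in the admissible range would do: this only shows that the set of quotients is
    -- nonempty, so that its `sInf` is not the default value `0`.
    obtain ⟨Q', hQ', hex⟩ := exists_rayleighValues_le hopen hbdd hD (s := D / 4) (by positivity)
      (by linarith)
    have hlim : Tendsto (fun p : ℝ => 1 / ((D + ε) / 2 * Q ^ (1 / p) + ε)) atTop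
        (𝓝 (1 / ((D + ε) / 2 * 1 + ε))) :=
      tendsto_const_nhds.div (((tendsto_rpow_one_div_atTop hQ).const_mul _).add_const _)
        (by positivity)
    rw [mul_one] at hlim
    filter_upwards [hlim.eventually_const_lt haε, eventually_ge_atTop 2] with p hp hp2
    refine hp.trans_le ?_
    have hp0 : 0 < p := by linarith
    obtain ⟨r, hr, -⟩ := hex p hp2
    have h1 : (1 / ((D + ε) / 2 * Q ^ (1 / p) + ε)) ^ p ≤ neumannEigenvalue Ω p :=
      le_csInf ⟨r, hr⟩ (hle p (by linarith))
    have h2 := Real.rpow_le_rpow (by positivity) h1 (by positivity : 0 ≤ 1 / p)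
    rwa [← Real.rpow_mul (by positivity), mul_one_div_cancel hp0.ne', Real.rpow_one] at h2
  · intro b hb
    have hb0 : 0 < b := lt_trans (by positivity) hb
    -- Since `2 / D < b`, there is room for `s < D / 2` with `1 / s < b`.
    obtain ⟨s, hs1, hs2⟩ : ∃ s : ℝ, 1 / b < s ∧ s < D / 2 := exists_between (by
      have hb' := (div_lt_iff₀ hD0').1 hb
      rw [div_lt_iff₀ hb0]; linarith)
    have hs0 : 0 < s := lt_trans (by positivity) hs1
    obtain ⟨Q, hQ, hex⟩ := exists_rayleighValues_le hopen hbdd hD hs0 hs2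
    have hlim := (tendsto_rpow_one_div_atTop hQ).div_const s
    have hsb : 1 / s < b := by
      rw [div_lt_iff₀ hb0] at hs1
      rw [div_lt_iff₀ hs0]; linarith
    filter_upwards [hlim.eventually_lt_const hsb, eventually_ge_atTop 2] with p hp hp2
    refine lt_of_le_of_lt ?_ hp
    have hp0 : 0 < p := by linarith
    obtain ⟨r, hr, hrle⟩ := hex p hp2
    have h1 : neumannEigenvalue Ω p ≤ Q / s ^ p :=
      (csInf_le ⟨0, fun _ h => rayleighValues_nonneg h⟩ hr).trans hrle
    have h0 : 0 ≤ neumannEigenvalue Ω p := Real.sInf_nonneg fun _ h => rayleighValues_nonneg h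
    have h2 := Real.rpow_le_rpow h0 h1 (by positivity : 0 ≤ 1 / p)
    rwa [Real.div_rpow hQ.le (by positivity), ← Real.rpow_mul hs0.le, mul_one_div_cancel hp0.ne',
      Real.rpow_one] at h2

end NeumannPLaplace

theorem lemma5p4 {n : ℕ} (hn : 1 ≤ n) (Ω : Set (NeumannPLaplace.E n))
    (hopen : IsOpen Ω) (hbdd : Bornology.IsBounded Ω) (hsc : IsSimplyConnected Ω)
    (hLip : NeumannPLaplace.HasLipschitzBoundary Ω) :
    0 < NeumannPLaplace.intrinsicDiam Ω ∧ NeumannPLaplace.intrinsicDiam Ω < ⊤ ∧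
      Tendsto (fun p : ℝ => NeumannPLaplace.neumannLambda Ω p) atTop
        (𝓝 (2 / (NeumannPLaplace.intrinsicDiam Ω).toReal)) := by
  have hpos := NeumannPLaplace.intrinsicDiam_pos hn hopen hsc.nonempty
  have hfin := NeumannPLaplace.intrinsicDiam_lt_top hopen hbdd
    hsc.isPathConnected.isConnected.isPreconnected hLip
  refine ⟨hpos, hfin, ?_⟩
  exact NeumannPLaplace.tendsto_neumannLambda hopen hbdd hLip
    (ENNReal.toNNReal_pos hpos.ne' hfin.ne) (ENNReal.coe_toNNReal hfin.ne).symm
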